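/- Let $\zeta\colon\mathbb R^d\to\mathbb R$ be a $\mathcal C^\infty$ function, put $g=\nabla\zeta$ and $G=|g|^2$, and let $\mathcal M=\{x\in\mathbb R^d:\zeta(x)=0\}$. Assume that $\mathcal M$ is compact and that $G>0$ on $\mathcal M$ (so that $\mathcal M$ is a smooth compact hypersurface). Let $\sigma_{\mathcal M}$ be the surface measure on $\mathcal M$ induced by the Euclidean metric of $\mathbb R^d$ (the normalised $(d-1)$-dimensional Hausdorff measure restricted to $\mathcal M$). Let $\Pi_{\mathcal M}=I-G^{-1}gg^T$ be the orthogonal projection on the tangent spaces, $\nabla_{\mathcal M}\psi=\Pi_{\mathcal M}\nabla\psi$, and $\mathrm{Div}_{\mathcal M}(H)=\mathrm{Div}(H)-G^{-1}(g,H'g)$. Here $(\cdot,\cdot)$ is the Euclidean inner product, and a prime denotes the differential in $\mathbb R^d$: $\psi'H=(\nabla\psi,H)$, and $H'v$ is the derivative of $H$ in the direction $v$. (1) For all $\mathcal C^\infty$ functions $\psi\colon\mathbb R^d\to\mathbb R$ and $H\colon\mathbb R^d\to\mathbb R^d$, $$\int_{\mathcal M}(\nabla_{\mathcal M}\psi,H)\,d\sigma_{\mathcal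 M}=-\int_{\mathcal M}\psi\,\mathrm{Div}_{\mathcal M}(\Pi_{\mathcal M}H)\,d\sigma_{\mathcal M},$$ both integrals being absolutely convergent. (2) Let $V\colon\mathbb R^d\to\mathbb R$ be $\mathcal C^\infty$, $\sigma>0$, $f=-\nabla V$, and let $d\mu_\infty=\rho_\infty\,d\sigma_{\mathcal M}$ with $\rho_\infty=\frac1Z\exp\left(-\frac{2}{\sigma^2}V\right)$ and $Z=\int_{\mathcal M}\exp\left(-\frac2{\sigma^2}V\right)d\sigma_{\mathcal M}$. If $\mathcal M\neq\emptyset$, then $\mu_\infty$ is a probability measure. For all $\mathcal C^\infty$ functions $\psi\colon\mathbb R^d\to\mathbb R$ and $H\colon\mathbb R^d\to\mathbb R^d$ and all real $k\ge0$, \begin{align*} \int_{\mathcal M}\Big[G^{-k}\psi'H-G^{-(k+1)}(g,H)\psi'g\Big]d\mu_\infty =\int_{\mathcal M}\Big[&G^{-(k+1)}(g,H'g)\psi-(2k+1)G^{-(k+2)}(g,g'g)(g,H)\psi\\ &-G^{-k}\mathrm{Div}(H)\psi+2kG^{-(k+1)}(g,g'H)\psi\\ &+G^{-(k+1)}\mathrm{Div}(g)(g,H)\psi+\frac2{\sigma^2}G^{-(k+1)}(g,f)(g,H)\psi\\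 &-\frac2{\sigma^2}G^{-k}(f,H)\psi\Big]d\mu_\infty, \end{align*} both integrals being absolutely convergent. -/

import Mathlib

open MeasureTheory
open scoped ContDiff RealInnerProductSpace Gradient

namespace ConstrainedLangevin

noncomputable section

/-- The set `M = {x ∈ ℝ^d : ζ x = 0}` cut out by a scalar constraint `ζ`. -/
def zeroSet {d : ℕ} (ζ : EuclideanSpace ℝ (Fin d) → ℝ) : Set (EuclideanSpace ℝ (Fin d)) :=
  {x | ζ x = 0}

/-- The Gram function `G = |∇ζ|²`. -/
def gram {d : ℕ} (ζ : EuclideanSpace ℝ (Fin d) → ℝ) (x : EuclideanSpace ℝ (Fin d)) : ℝ :=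
  ⟪∇ ζ x, ∇ ζ x⟫

/-- The orthogonal projection on the tangent space, `Π_M v = v - G⁻¹ (g, v) g` with `g = ∇ζ`. -/
def tangentProj {d : ℕ} (ζ : EuclideanSpace ℝ (Fin d) → ℝ) (x v : EuclideanSpace ℝ (Fin d)) :
    EuclideanSpace ℝ (Fin d) :=
  v - ((gram ζ x)⁻¹ * ⟪∇ ζ x, v⟫) • ∇ ζ x

/-- The tangential gradient `∇_M ψ = Π_M ∇ψ`. -/
def tangentGrad {d : ℕ} (ζ ψ : EuclideanSpace ℝ (Fin d) → ℝ) (x : EuclideanSpace ℝ (Fin d)) :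
    EuclideanSpace ℝ (Fin d) :=
  tangentProj ζ x (∇ ψ x)

/-- The divergence `∑ i, ∂ᵢ Hᵢ` of a vector field on `ℝ^d`. -/
def div {d : ℕ} (H : EuclideanSpace ℝ (Fin d) → EuclideanSpace ℝ (Fin d))
    (x : EuclideanSpace ℝ (Fin d)) : ℝ :=
  ∑ i : Fin d, (fderiv ℝ H x (EuclideanSpace.single i 1)) i

/-- The divergence along `M`: `Div_M H = Div H - G⁻¹ (g, H' g)` with `g = ∇ζ`. -/
def tangentDiv {d : ℕ} (ζ : EuclideanSpace ℝ (Fin d) → ℝ)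
    (H : EuclideanSpace ℝ (Fin d) → EuclideanSpace ℝ (Fin d))
    (x : EuclideanSpace ℝ (Fin d)) : ℝ :=
  div H x - (gram ζ x)⁻¹ * ⟪∇ ζ x, fderiv ℝ H x (∇ ζ x)⟫

/-- The canonical measure `σ_M` on the hypersurface `M` induced by the Euclidean metric of `ℝ^d`,
seen as a measure on `ℝ^d`: the `(d - 1)`-dimensional Hausdorff measure (normalised so as to agree
with Lebesgue measure on `ℝ^(d - 1)`) restricted to `M`. -/
def surfaceMeasure {d : ℕ} (ζ : EuclideanSpace ℝ (Fin d) → ℝ) :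
    Measure (EuclideanSpace ℝ (Fin d)) :=
  (μHE[d - 1]).restrict (zeroSet ζ)

/-- The normalising constant `Z = ∫_M exp(-2V/σ²) dσ_M`. -/
def partitionFun {d : ℕ} (ζ V : EuclideanSpace ℝ (Fin d) → ℝ) (σ : ℝ) : ℝ :=
  ∫ x, Real.exp (-(2 / σ ^ 2) * V x) ∂(surfaceMeasure ζ)

/-- The density `ρ_∞ = Z⁻¹ exp(-2V/σ²)`. -/
def gibbsDensity {d : ℕ} (ζ V : EuclideanSpace ℝ (Fin d) → ℝ) (σ : ℝ)
    (x : EuclideanSpace ℝ (Fin d)) : ℝ :=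
  (partitionFun ζ V σ)⁻¹ * Real.exp (-(2 / σ ^ 2) * V x)

/-- The invariant measure `dμ_∞ = ρ_∞ dσ_M`. -/
def gibbsMeasure {d : ℕ} (ζ V : EuclideanSpace ℝ (Fin d) → ℝ) (σ : ℝ) :
    Measure (EuclideanSpace ℝ (Fin d)) :=
  (surfaceMeasure ζ).withDensity (fun x => ENNReal.ofReal (gibbsDensity ζ V σ x))

/-- `∫ F dμ = ∫ K dμ`, where both integrals are required to converge absolutely. -/
def IntegralsAgree {d : ℕ} (μ : Measure (EuclideanSpace ℝ (Fin d)))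
    (F K : EuclideanSpace ℝ (Fin d) → ℝ) : Prop :=
  Integrable F μ ∧ Integrable K μ ∧ ∫ x, F x ∂μ = ∫ x, K x ∂μ

end

end ConstrainedLangevin

/-!
The proof avoids the area formula. The hypersurface is seen as a limit of thin layers
`{|ζ| < δ}` of the ambient space, where the divergence theorem is elementary.

*The layers converge to the surface measure* (`tendsto_integral_levelSet`). If `η_δ` is an
approximate identity on the line and `u` is continuous with compact support, then
`∫ η_δ(ζ) |∇ζ| u dx → ∫_M u dσ_M`. Near a point `x₀` of `M`, put `c = |∇ζ(x₀)|` and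
`n = ∇ζ(x₀) / c`. The map `x ↦ x + (ζ(x) / c - ⟪n, x⟫) n` carries the level sets of `ζ` to
hyperplanes and has derivative the identity at `x₀`, so that on a small neighbourhood it is
bi-Lipschitz with a constant `K` as close to `1` as desired (`exists_straightening`). It therefore
distorts both the Lebesgue measure and the `(d - 1)`-dimensional Hausdorff measure by at most a
power of `K` (`lintegral_comp_symm_le`), which reduces the claim, up to such a factor, to the case
of a hyperplane, where it is Fubini's theorem (`IsApproxIdentity.tendsto_hyperplane`). A partition
of unity globalises the two-sided estimates (`nearLimit_levelSet`), and then `K → 1`. The same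
comparison shows that `σ_M` is finite, and nonzero if `M` is nonempty.

*The divergence theorem on `M`* (`integral_tangentDiv_eq_zero`). Let `W` be a compactly supported
field tangent to the level sets of `ζ`. Since `⟪∇ζ, W⟫ = 0`, the field `η_δ(ζ) |∇ζ| W` has
divergence `η_δ(ζ) div(|∇ζ| W)`, and differentiating `⟪∇ζ, W⟫ = 0` in the direction `∇ζ` shows that
`div(|∇ζ| W) = |∇ζ| Div_M W` (`div_norm_gradient_smul`). The integral of this divergence vanishes,
and `δ → 0` gives `∫_M Div_M W dσ_M = 0`.

*The two integration by parts formulas.* Applied to the field `ψ Π_M H`, this is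
`integralsAgree_surfaceMeasure`. The formula for the Gibbs measure is the same one for the field
`G ^ (-k) ρ_∞ H`, expanded by the product rules for `Div_M`. That field is smooth only near `M`, so
the first formula is proved for fields that are `C^1` at the points of `M`.
-/

namespace ConstrainedLangevin

open Measure Filter Topology Set Module
open scoped ENNReal NNReal

/-! ### Hausdorff measures under Lipschitz homeomorphisms -/

section Lipschitz

variable {X Y : Type*} [EMetricSpace X] [MeasurableSpace X] [BorelSpace X]
  [EMetricSpace Y] [MeasurableSpace Y] [BorelSpace Y]

lemma euclideanHausdorffMeasure_image_le_of_lipschitzOnWith {f : X → Y} {s : Set X} {K : ℝ≥0}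
    (h : LipschitzOnWith K f s) (k : ℕ) : μHE[k] (f '' s) ≤ (K : ℝ≥0∞) ^ k * μHE[k] s := by
  simp_rw [euclideanHausdorffMeasure_def, Measure.smul_apply, ENNReal.smul_def, smul_eq_mul]
  have := h.hausdorffMeasure_image_le (d := (k : ℝ)) (by positivity)
  rw [ENNReal.rpow_natCast] at this
  calc _ ≤ _ := mul_le_mul_right this _
    _ = _ := by ring

/-- A change of variables inequality: pulling back by a `K`-Lipschitz homeomorphism `e` multiplies
integrals for the `k`-dimensional Hausdorff measure by at most `K ^ k`. -/
lemma lintegral_comp_symm_le (e : OpenPartialHomeomorph X Y) {K : ℝ≥0}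
    (hK : LipschitzOnWith K e e.source) (k : ℕ) {S : Set X} {S' : Set Y}
    (hS' : MeasurableSet S') (hSS' : ∀ x ∈ e.source, e x ∈ S' ↔ x ∈ S) {f : X → ℝ≥0∞}
    (hf : Measurable f) :
    ∫⁻ z in e.target ∩ S', f (e.symm z) ∂μHE[k] ≤
      (K : ℝ≥0∞) ^ k * ∫⁻ x in e.source ∩ S, f x ∂μHE[k] := by
  have hm : MeasurableSet (e.target ∩ S') := e.open_target.measurableSet.inter hS'
  have hp : AEMeasurable e.symm ((μHE[k] : Measure Y).restrict (e.target ∩ S')) :=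
    (e.continuousOn_symm.mono inter_subset_left).aemeasurable hm
  have hle : ((μHE[k] : Measure Y).restrict (e.target ∩ S')).map e.symm ≤
      (K : ℝ≥0∞) ^ k • (μHE[k] : Measure X).restrict (e.source ∩ S) := by
    refine Measure.le_iff.2 fun B hB => ?_
    rw [Measure.map_apply_of_aemeasurable hp hB, Measure.smul_apply, smul_eq_mul,
      Measure.restrict_apply hB, Measure.restrict_apply' hm]
    have : e.symm ⁻¹' B ∩ (e.target ∩ S') ⊆ e '' (B ∩ (e.source ∩ S)) := by
      rintro z ⟨hzB, hzt, hzS⟩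
      refine ⟨e.symm z, ⟨hzB, e.map_target hzt, ?_⟩, e.right_inv hzt⟩
      rw [← hSS' _ (e.map_target hzt), e.right_inv hzt]
      exact hzS
    refine (measure_mono this).trans ?_
    exact euclideanHausdorffMeasure_image_le_of_lipschitzOnWith
      (hK.mono fun x hx => hx.2.1) k
  rw [← lintegral_map' hf.aemeasurable hp]
  refine (lintegral_mono' hle le_rfl).trans ?_
  rw [lintegral_smul_measure, smul_eq_mul]

end Lipschitz

/-! ### Approximate identities on the line -/

section ApproximateIdentity

variable {ι : Type*}

/-- A family of nonnegative kernels on the line, of total mass one, whose supports shrink to the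
origin along the filter `l`. -/
structure IsApproxIdentity (l : Filter ι) (ρ : ι → ℝ → ℝ≥0∞) : Prop where
  measurable : ∀ i, Measurable (ρ i)
  lintegral_eq_one : ∀ i, ∫⁻ t, ρ i t = 1
  eventually_eq_zero : ∀ r : ℝ, 0 < r → ∀ᶠ i in l, ∀ t, r ≤ |t| → ρ i t = 0

lemma IsApproxIdentity.comp_mul_left {l : Filter ι} {ρ : ι → ℝ → ℝ≥0∞}
    (h : IsApproxIdentity l ρ) {c : ℝ} (hc : 0 < c) :
    IsApproxIdentity l fun i t => ENNReal.ofReal c * ρ i (c * t) where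
  measurable i := ((h.measurable i).comp (measurable_const_mul c)).const_mul _
  lintegral_eq_one i := by
    have hm : Measurable fun t => ρ i (c * t) := (h.measurable i).comp (measurable_const_mul c)
    rw [lintegral_const_mul _ hm]
    have h1 := (Homeomorph.mulLeft₀ c hc.ne').toMeasurableEquiv.measurableEmbedding.lintegral_map
      (μ := volume) (ρ i)
    have h2 : Measure.map (Homeomorph.mulLeft₀ c hc.ne').toMeasurableEquiv volume
        = ENNReal.ofReal c⁻¹ • (volume : Measure ℝ) := by
      have := Real.map_volume_mul_left hc.ne'
      rw [abs_of_pos (inv_pos.2 hc)] at this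
      exact this
    rw [h2, lintegral_smul_measure, h.lintegral_eq_one, smul_eq_mul, mul_one] at h1
    have h3 : ∫⁻ t, ρ i (c * t) = ENNReal.ofReal c⁻¹ := h1.symm
    rw [h3, ← ENNReal.ofReal_mul hc.le, mul_inv_cancel₀ hc.ne', ENNReal.ofReal_one]
  eventually_eq_zero r hr := by
    filter_upwards [h.eventually_eq_zero (c * r) (by positivity)] with i hi t ht
    rw [hi, mul_zero]
    rw [abs_mul, abs_of_pos hc]
    gcongr

lemma IsApproxIdentity.tendsto_lintegral_mul {l : Filter ι} {ρ : ι → ℝ → ℝ≥0∞}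
    (h : IsApproxIdentity l ρ) {f : ℝ → ℝ≥0∞} (hf : ContinuousAt f 0) :
    Tendsto (fun i => ∫⁻ t, ρ i t * f t) l (𝓝 (f 0)) := by
  refine tendsto_order.2 ⟨fun b hb => ?_, fun b hb => ?_⟩
  · obtain ⟨b', hb', hb'f⟩ := exists_between hb
    obtain ⟨r, hr, hrf⟩ := Metric.eventually_nhds_iff.1 (hf.eventually (lt_mem_nhds hb'f))
    filter_upwards [h.eventually_eq_zero r hr] with i hi
    calc b < b' := hb'
      _ = ∫⁻ t, ρ i t * b' := by
        rw [lintegral_mul_const _ (h.measurable i), h.lintegral_eq_one, one_mul]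
      _ ≤ ∫⁻ t, ρ i t * f t := by
        refine lintegral_mono fun t => ?_
        by_cases ht : r ≤ |t|
        · simp [hi t ht]
        · exact mul_le_mul_right (hrf (by simpa using ht)).le _
  · obtain ⟨b', hb'f, hb'⟩ := exists_between hb
    obtain ⟨r, hr, hrf⟩ := Metric.eventually_nhds_iff.1 (hf.eventually (gt_mem_nhds hb'f))
    filter_upwards [h.eventually_eq_zero r hr] with i hi
    calc ∫⁻ t, ρ i t * f t ≤ ∫⁻ t, ρ i t * b' := by
          refine lintegral_mono fun t => ?_
          by_cases ht : r ≤ |t|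
          · simp [hi t ht]
          · exact mul_le_mul_right (hrf (by simpa using ht)).le _
      _ = b' := by rw [lintegral_mul_const _ (h.measurable i), h.lintegral_eq_one, one_mul]
      _ < b := hb'

end ApproximateIdentity

/-! ### Thin layers around a hyperplane -/

section Hyperplane

variable {V : Type*} [NormedAddCommGroup V] [InnerProductSpace ℝ V] [FiniteDimensional ℝ V]
  [MeasurableSpace V] [BorelSpace V]

/-- The Lebesgue measure of a hyperplane is the restriction to it of the Hausdorff measure of
codimension one of the ambient space. -/
lemma map_orthogonal_singleton {n : V} (hn : n ≠ 0) :
    Measure.map (Subtype.val : (ℝ ∙ n)ᗮ → V) volume =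
      (μHE[finrank ℝ V - 1] : Measure V).restrict {z | ⟪n, z⟫ = 0} := by
  have hr : finrank ℝ (ℝ ∙ n)ᗮ = finrank ℝ V - 1 := by
    have := (ℝ ∙ n).finrank_add_finrank_orthogonal
    rw [finrank_span_singleton hn] at this
    omega
  rw [← InnerProductSpace.euclideanHausdorffMeasure_eq_volume, hr,
    (isometry_subtype_coe).map_euclideanHausdorffMeasure, Subtype.range_coe_subtype]
  congr 2
  ext z
  exact Submodule.mem_orthogonal_singleton_iff_inner_right

/-- Fubini's theorem for the slicing of a Euclidean space by the hyperplanes orthogonal to a unit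
vector. -/
lemma lintegral_eq_lintegral_hyperplanes {n : V} (hn : ‖n‖ = 1) {f : V → ℝ≥0∞}
    (hf : Measurable f) :
    ∫⁻ z, f z = ∫⁻ t : ℝ, ∫⁻ y : (ℝ ∙ n)ᗮ, f (t • n + y) := by
  have hn0 : n ≠ 0 := by rintro rfl; simp at hn
  have hV := (ℝ ∙ n).measurePreserving_measurableEquivProd (0 : V)
  rw [InnerProductSpace.euclideanHausdorffMeasure_eq_volume] at hV
  rw [← hV.symm.lintegral_comp_emb (MeasurableEquiv.measurableEmbedding _), volume_eq_prod,
    lintegral_prod]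
  swap
  · exact (hf.comp (MeasurableEquiv.measurable _)).aemeasurable
  let L : ℝ ≃ₗᵢ[ℝ] (ℝ ∙ n) := LinearIsometryEquiv.toSpanUnitSingleton n hn
  rw [← L.measurePreserving.lintegral_comp_emb
    L.toHomeomorph.toMeasurableEquiv.measurableEmbedding]
  simp [L]

/-- Integrals concentrated near a hyperplane converge to the integral over the hyperplane. -/
lemma IsApproxIdentity.tendsto_hyperplane {ι : Type*} {l : Filter ι}
    {ρ : ι → ℝ → ℝ≥0∞} (h : IsApproxIdentity l ρ) {n : V} (hn : ‖n‖ = 1) {w : V → ℝ≥0}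
    (hw : Continuous w) (hwc : HasCompactSupport w) :
    Tendsto (fun i => ∫⁻ z, ρ i ⟪n, z⟫ * w z) l
      (𝓝 (∫⁻ z in {z | ⟪n, z⟫ = 0}, w z ∂μHE[finrank ℝ V - 1])) := by
  have hn0 : n ≠ 0 := by rintro rfl; simp at hn
  set f : ℝ → ℝ≥0∞ := fun t => ∫⁻ y : (ℝ ∙ n)ᗮ, w (t • n + y) with hf
  have hin (t : ℝ) (y : (ℝ ∙ n)ᗮ) : ⟪n, t • n + (y : V)⟫ = t := by
    rw [inner_add_right, inner_smul_right, real_inner_self_eq_norm_sq, hn,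
      Submodule.mem_orthogonal_singleton_iff_inner_right.1 y.2]
    simp
  have hmeas : Measurable fun z => (w z : ℝ≥0∞) := hw.measurable.coe_nnreal_ennreal
  have hslice (t : ℝ) : Measurable fun y : (ℝ ∙ n)ᗮ => (w (t • n + y) : ℝ≥0∞) := by
    have : Continuous fun y : (ℝ ∙ n)ᗮ => t • n + (y : V) := by fun_prop
    exact hmeas.comp this.measurable
  have h0 : f 0 = ∫⁻ z in {z | ⟪n, z⟫ = 0}, w z ∂μHE[finrank ℝ V - 1] := by
    rw [← map_orthogonal_singleton hn0, lintegral_map hmeas measurable_subtype_coe]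
    simp [hf]
  -- The slices of `w` are uniformly bounded, with supports in the projection of that of `w`.
  have hcont : ContinuousAt f 0 := by
    let q := (ℝ ∙ n)ᗮ.orthogonalProjectionOnto
    have hcomp : IsCompact (q '' tsupport w) := hwc.isCompact.image q.continuous
    obtain ⟨C, hC⟩ := (hwc.isCompact_range hw).bddAbove
    refine tendsto_lintegral_filter_of_dominated_convergence
      ((q '' tsupport w).indicator fun _ => (C : ℝ≥0∞)) ?_ ?_ ?_ ?_
    · exact .of_forall hslice
    · refine .of_forall fun t => .of_forall fun y => ?_
      by_cases hy : w (t • n + y) = 0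
      · simp [hy]
      · have : y ∈ q '' tsupport w := by
          refine ⟨_, subset_tsupport _ hy, ?_⟩
          have hq : q n = 0 := by
            rw [Submodule.orthogonalProjectionOnto_eq_zero_iff]
            exact Submodule.le_orthogonal_orthogonal _ (Submodule.mem_span_singleton_self n)
          simp [q] at hq ⊢
        rw [indicator_of_mem this]
        exact ENNReal.coe_le_coe.2 (hC (mem_range_self _))
    · rw [lintegral_indicator hcomp.measurableSet, setLIntegral_const]
      exact ENNReal.mul_ne_top ENNReal.coe_ne_top hcomp.measure_lt_top.ne
    · refine .of_forall fun y => ?_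
      have : Continuous fun t : ℝ => (w (t • n + y) : ℝ≥0∞) := by fun_prop
      exact this.tendsto 0
  rw [← h0]
  refine (h.tendsto_lintegral_mul hcont).congr fun i => ?_
  rw [lintegral_eq_lintegral_hyperplanes hn]
  · refine lintegral_congr fun t => ?_
    simp_rw [hin]
    rw [lintegral_const_mul _ (hslice t)]
  · have : Continuous fun z => ⟪n, z⟫ := by fun_prop
    exact ((h.measurable i).comp this.measurable).mul hmeas

lemma lintegral_hyperplane_ne_top {n : V} (hn : n ≠ 0) {w : V → ℝ≥0}
    (hw : Continuous w) (hwc : HasCompactSupport w) :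
    ∫⁻ z in {z | ⟪n, z⟫ = 0}, w z ∂μHE[finrank ℝ V - 1] ≠ ⊤ := by
  rw [← map_orthogonal_singleton hn,
    lintegral_map hw.measurable.coe_nnreal_ennreal measurable_subtype_coe]
  have hc : HasCompactSupport fun y : (ℝ ∙ n)ᗮ => w y :=
    hwc.comp_isClosedEmbedding
      (Submodule.closed_of_finiteDimensional _).isClosedEmbedding_subtypeVal
  have hi : Integrable (fun y : (ℝ ∙ n)ᗮ => (w y : ℝ)) :=
    Continuous.integrable_of_hasCompactSupport (by fun_prop)
      (hc.comp_left (g := fun r : ℝ≥0 => (r : ℝ)) rfl)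
  have := hi.lintegral_lt_top
  simp only [ENNReal.ofReal_coe_nnreal] at this
  exact this.ne

end Hyperplane

/-! ### Straightening the level sets -/

section Chart

variable {V : Type*} [NormedAddCommGroup V] [InnerProductSpace ℝ V] [FiniteDimensional ℝ V]

lemma continuous_gradient {ζ : V → ℝ} (hζ : ContDiff ℝ 1 ζ) : Continuous (∇ ζ) :=
  (InnerProductSpace.toDual ℝ V).symm.continuous.comp (hζ.continuous_fderiv one_ne_zero)

/-- Near a regular point `x₀`, the map `x ↦ x + (ζ x / c - ⟪n, x⟫) n`, where `c = ‖∇ζ x₀‖` and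
`n = ∇ζ x₀ / c`, straightens the level sets of `ζ` to hyperplanes. Its derivative at `x₀` is the
identity, so it is as close to an isometry as desired. -/
lemma exists_straightening {ζ : V → ℝ} (hζ : ContDiff ℝ 1 ζ) {x₀ : V} (hx₀ : ∇ ζ x₀ ≠ 0)
    {K : ℝ≥0} (hK : 1 < K) :
    ∃ (e : OpenPartialHomeomorph V V) (n : V) (c : ℝ), ‖n‖ = 1 ∧ 0 < c ∧ x₀ ∈ e.source ∧
      LipschitzOnWith K e e.source ∧ LipschitzOnWith K e.symm e.target ∧
      ∀ x ∈ e.source, c * ⟪n, e x⟫ = ζ x ∧ ‖∇ ζ x‖ ≤ K * c ∧ c ≤ K * ‖∇ ζ x‖ := by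
  set c : ℝ := ‖∇ ζ x₀‖ with hc
  have hc0 : 0 < c := norm_pos_iff.2 hx₀
  set n : V := c⁻¹ • ∇ ζ x₀ with hn
  have hcn : c • n = ∇ ζ x₀ := by rw [hn, smul_smul, mul_inv_cancel₀ hc0.ne', one_smul]
  have hn1 : ‖n‖ = 1 := by rw [hn, norm_smul, norm_inv, norm_norm, inv_mul_cancel₀ hc0.ne']
  have hnn : ⟪n, n⟫ = 1 := by rw [real_inner_self_eq_norm_sq, hn1, one_pow]
  have : Nontrivial V := ⟨⟨n, 0, by rintro h; simp [h] at hn1⟩⟩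
  set F : V → V := fun x => x + (c⁻¹ * ζ x - ⟪n, x⟫) • n with hF
  have hK0 : (0 : ℝ) < K := by exact_mod_cast zero_lt_one.trans hK
  have hK1 : (1 : ℝ) < K := by exact_mod_cast hK
  -- With this `ε`, both `1 + ε` and `(1 - ε)⁻¹` are at most `K`.
  set ε : ℝ≥0 := 1 - K⁻¹ with hε
  have hKi : K⁻¹ < 1 := inv_lt_one_of_one_lt₀ hK
  have hεr : (ε : ℝ) = 1 - (K : ℝ)⁻¹ := by
    rw [hε, NNReal.coe_sub hKi.le]; simp
  have hε0 : 0 < ε := tsub_pos_of_lt hKi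
  have hε1 : ε < 1 := by
    rw [← NNReal.coe_lt_coe, hεr]; simp [hK0]
  have hder : HasStrictFDerivAt F
      ((ContinuousLinearEquiv.refl ℝ V : V ≃L[ℝ] V) : V →L[ℝ] V) x₀ := by
    have h1 : HasStrictFDerivAt ζ (fderiv ℝ ζ x₀) x₀ :=
      hζ.contDiffAt.hasStrictFDerivAt one_ne_zero
    have h2 := (hasStrictFDerivAt_id (𝕜 := ℝ) x₀).add
      (((h1.const_mul c⁻¹).sub (innerSL ℝ n).hasStrictFDerivAt).smul_const n)
    refine h2.congr_fderiv ?_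
    ext v
    have : fderiv ℝ ζ x₀ v = c * ⟪n, v⟫ := by
      rw [← inner_gradient_left, ← hcn, inner_smul_left]; rfl
    simp [this, inv_mul_cancel_left₀ hc0.ne']
  obtain ⟨s, hs, hsF⟩ := hder.approximates_deriv_on_nhds (Or.inr hε0)
  have hgrad := (continuous_gradient hζ).norm
  have h1 : {x | ‖∇ ζ x‖ < K * c} ∈ 𝓝 x₀ :=
    hgrad.continuousAt.eventually (gt_mem_nhds (by simpa using lt_mul_of_one_lt_left hc0 hK1))
  have h2 : {x | (K : ℝ)⁻¹ * c < ‖∇ ζ x‖} ∈ 𝓝 x₀ :=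
    hgrad.continuousAt.eventually (lt_mem_nhds (by
      simpa using mul_lt_of_lt_one_left hc0 (inv_lt_one_of_one_lt₀ hK1)))
  obtain ⟨U, hU, hUo, hxU⟩ := mem_nhds_iff.1 (inter_mem hs (inter_mem h1 h2))
  have hUF := hsF.mono_set (hU.trans inter_subset_left)
  have hεN : ε < ‖((ContinuousLinearEquiv.refl ℝ V).symm : V →L[ℝ] V)‖₊⁻¹ := by
    simpa using hε1
  set e := hUF.toOpenPartialHomeomorph F U (Or.inr hεN) hUo with he
  have hes : e.source = U := rfl
  have heF : ∀ x, e x = F x := fun _ => rfl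
  have happ : ∀ x ∈ U, ∀ y ∈ U, ‖F x - F y - (x - y)‖ ≤ ε * ‖x - y‖ := fun x hx y hy => by
    simpa using hUF x hx y hy
  refine ⟨e, n, c, hn1, hc0, hxU, ?_, ?_, ?_⟩
  · refine LipschitzOnWith.of_dist_le_mul fun x hx y hy => ?_
    rw [dist_eq_norm, dist_eq_norm, heF, heF]
    calc ‖F x - F y‖ ≤ ‖F x - F y - (x - y)‖ + ‖x - y‖ := by
          simpa using norm_add_le (F x - F y - (x - y)) (x - y)
      _ ≤ ε * ‖x - y‖ + ‖x - y‖ := by gcongr; exact happ x hx y hy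
      _ = (1 + ε) * ‖x - y‖ := by ring
      _ ≤ K * ‖x - y‖ := by
        gcongr
        rw [hεr]
        have : 0 ≤ ((K : ℝ) - 1) ^ 2 / K := by positivity
        have h3 : ((K : ℝ) - 1) ^ 2 / K = K - 2 + (K : ℝ)⁻¹ := by field_simp; ring
        linarith
  · refine LipschitzOnWith.of_dist_le_mul fun x hx y hy => ?_
    have hx' := e.map_target hx
    have hy' := e.map_target hy
    obtain ⟨a, ha, rfl⟩ : ∃ a ∈ U, e a = x := ⟨_, hx', e.right_inv hx⟩
    obtain ⟨b, hb, rfl⟩ : ∃ b ∈ U, e b = y := ⟨_, hy', e.right_inv hy⟩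
    rw [e.left_inv ha, e.left_inv hb, dist_eq_norm, dist_eq_norm, heF, heF]
    have h3 := happ a ha b hb
    have h4 : ‖a - b‖ ≤ ‖F a - F b - (a - b)‖ + ‖F a - F b‖ := by
      have := norm_sub_le (F a - F b) (F a - F b - (a - b))
      rw [sub_sub_cancel] at this
      linarith
    rw [hεr] at h3
    have h5 : (K : ℝ)⁻¹ * ‖a - b‖ ≤ ‖F a - F b‖ := by linarith
    rwa [inv_mul_le_iff₀ hK0] at h5
  · intro x hx
    refine ⟨?_, (hU hx).2.1.le, ?_⟩
    · rw [heF, hF]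
      simp only [inner_add_right, inner_smul_right, hnn]
      rw [mul_one, add_sub_cancel, mul_inv_cancel_left₀ hc0.ne']
    · have : (K : ℝ)⁻¹ * c < ‖∇ ζ x‖ := (hU hx).2.2
      exact (inv_mul_le_iff₀ hK0).1 this.le

end Chart

/-! ### Limits up to a multiplicative constant -/

section NearLimit

variable {ι : Type*} {l : Filter ι} {C : ℝ≥0∞}

/-- Up to a factor `C` in both directions, the family `a` agrees with a convergent family and `s`
agrees with its limit, which is finite. This is a form of approximate convergence of `a` to `s` that
is stable under finite sums. -/
def NearLimit (l : Filter ι) (C : ℝ≥0∞) (a : ι → ℝ≥0∞) (s : ℝ≥0∞) : Prop :=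
  ∃ (b : ι → ℝ≥0∞) (L : ℝ≥0∞), L ≠ ⊤ ∧ Tendsto b l (𝓝 L) ∧
    (∀ᶠ i in l, a i ≤ C * b i ∧ b i ≤ C * a i) ∧ s ≤ C * L ∧ L ≤ C * s

lemma NearLimit.of_eventually_eq_zero {a : ι → ℝ≥0∞} {s : ℝ≥0∞} (ha : ∀ᶠ i in l, a i = 0)
    (hs : s = 0) : NearLimit l C a s :=
  ⟨fun _ => 0, 0, by simp, tendsto_const_nhds, by filter_upwards [ha] with i hi; simp [hi],
    by simp [hs], by simp⟩

lemma NearLimit.add {a a' : ι → ℝ≥0∞} {s s' : ℝ≥0∞} (h : NearLimit l C a s)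
    (h' : NearLimit l C a' s') : NearLimit l C (fun i => a i + a' i) (s + s') := by
  obtain ⟨b, L, hL, hb, hab, h1, h2⟩ := h
  obtain ⟨b', L', hL', hb', hab', h1', h2'⟩ := h'
  refine ⟨fun i => b i + b' i, L + L', by simp [hL, hL'], hb.add hb', ?_, ?_, ?_⟩
  · filter_upwards [hab, hab'] with i hi hi'
    rw [mul_add, mul_add]
    exact ⟨add_le_add hi.1 hi'.1, add_le_add hi.2 hi'.2⟩
  · rw [mul_add]; exact add_le_add h1 h1'
  · rw [mul_add]; exact add_le_add h2 h2'

lemma NearLimit.sum {α : Type*} (t : Finset α) {a : α → ι → ℝ≥0∞} {s : α → ℝ≥0∞}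
    (h : ∀ j ∈ t, NearLimit l C (a j) (s j)) :
    NearLimit l C (fun i => ∑ j ∈ t, a j i) (∑ j ∈ t, s j) := by
  classical
  induction t using Finset.induction_on with
  | empty => exact .of_eventually_eq_zero (by simp) (by simp)
  | insert j t hj ih =>
    simp_rw [Finset.sum_insert hj]
    exact (h j (by simp)).add (ih fun k hk => h k (by simp [hk]))

lemma NearLimit.ne_top {a : ι → ℝ≥0∞} {s : ℝ≥0∞} (h : NearLimit l C a s) (hC : C ≠ ⊤) :
    s ≠ ⊤ := by
  obtain ⟨b, L, hL, -, -, h1, -⟩ := h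
  exact ne_top_of_le_ne_top (ENNReal.mul_ne_top hC hL) h1

lemma tendsto_of_nearLimit {a : ι → ℝ≥0∞} {s : ℝ≥0∞}
    (h : ∀ C : ℝ≥0, 1 < C → NearLimit l C a s) : Tendsto a l (𝓝 s) := by
  have hlim : Tendsto (fun C : ℝ≥0 => ((C * C : ℝ≥0) : ℝ≥0∞)) (𝓝[>] 1) (𝓝 1) := by
    have : Continuous fun C : ℝ≥0 => ((C * C : ℝ≥0) : ℝ≥0∞) := by fun_prop
    simpa using (this.tendsto 1).mono_left nhdsWithin_le_nhds
  have hself : ∀ᶠ C : ℝ≥0 in 𝓝[>] 1, 1 < C := self_mem_nhdsWithin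
  have hs : s ≠ ⊤ := (h 2 one_lt_two).ne_top ENNReal.coe_ne_top
  refine tendsto_order.2 ⟨fun r hr => ?_, fun r hr => ?_⟩
  · have h1 : Tendsto (fun C : ℝ≥0 => ((C * C : ℝ≥0) : ℝ≥0∞) * r) (𝓝[>] 1) (𝓝 (1 * r)) :=
      ENNReal.Tendsto.mul_const hlim (Or.inl one_ne_zero)
    rw [one_mul] at h1
    obtain ⟨C, hC, hC1⟩ := ((h1.eventually (gt_mem_nhds hr)).and hself).exists
    obtain ⟨b, L, hL, hb, hab, h1, h2⟩ := h C hC1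
    have hC0 : (C : ℝ≥0∞) ≠ 0 := by exact_mod_cast (zero_lt_one.trans hC1).ne'
    have hrL : C * r < L := by
      refine (ENNReal.mul_lt_mul_iff_right hC0 ENNReal.coe_ne_top).1 ?_
      refine lt_of_lt_of_le ?_ h1
      rwa [← mul_assoc, ← ENNReal.coe_mul]
    filter_upwards [hab, hb.eventually (lt_mem_nhds hrL)] with i hi hi'
    exact (ENNReal.mul_lt_mul_iff_right hC0 ENNReal.coe_ne_top).1 (hi'.trans_le hi.2)
  · have h1 : Tendsto (fun C : ℝ≥0 => ((C * C : ℝ≥0) : ℝ≥0∞) * s) (𝓝[>] 1) (𝓝 (1 * s)) :=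
      ENNReal.Tendsto.mul_const hlim (Or.inl one_ne_zero)
    rw [one_mul] at h1
    obtain ⟨C, hC, hC1⟩ := ((h1.eventually (gt_mem_nhds hr)).and hself).exists
    obtain ⟨b, L, hL, hb, hab, h1, h2⟩ := h C hC1
    have hrL : C * L < r := by
      refine lt_of_le_of_lt (mul_le_mul_right h2 _) ?_
      rwa [← mul_assoc, ← ENNReal.coe_mul]
    have hCb : Tendsto (fun i => C * b i) l (𝓝 (C * L)) :=
      ENNReal.Tendsto.const_mul hb (Or.inr ENNReal.coe_ne_top)
    filter_upwards [hab, hCb.eventually (gt_mem_nhds hrL)] with i hi hi'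
    exact hi.1.trans_lt hi'

end NearLimit

/-! ### Thin layers around a regular level set -/

section Coarea

lemma setLIntegral_inter_of_eq_zero {α : Type*} [MeasurableSpace α] {μ : Measure α} {A B : Set α}
    (hA : MeasurableSet A) {f : α → ℝ≥0∞} (h : ∀ x ∉ A, f x = 0) :
    ∫⁻ x in A ∩ B, f x ∂μ = ∫⁻ x in B, f x ∂μ := by
  rw [← Measure.restrict_restrict hA, ← lintegral_indicator hA]
  refine lintegral_congr fun x => ?_
  by_cases hx : x ∈ A <;> simp [hx, h]

/-- Extending by zero the transport of a compactly supported function along an open partial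
homeomorphism gives a compactly supported continuous function. -/
lemma exists_transport {X Y : Type*} [TopologicalSpace X]
    [TopologicalSpace Y] [T2Space Y] (e : OpenPartialHomeomorph X Y) {v : X → ℝ≥0}
    (hv : Continuous v) (hvc : HasCompactSupport v) (hve : tsupport v ⊆ e.source) :
    ∃ w : Y → ℝ≥0, Continuous w ∧ HasCompactSupport w ∧ (∀ z ∉ e.target, w z = 0) ∧
      (∀ x ∈ e.source, w (e x) = v x) := by
  classical
  set w : Y → ℝ≥0 := e.target.indicator (v ∘ e.symm) with hw
  have hK : IsCompact (e '' tsupport v) := hvc.isCompact.image_of_continuousOn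
    (e.continuousOn.mono hve)
  have hzero : ∀ z ∉ e '' tsupport v, w z = 0 := by
    intro z hz
    by_cases hzt : z ∈ e.target
    · rw [hw, indicator_of_mem hzt]
      by_contra h
      exact hz ⟨e.symm z, subset_tsupport _ h, e.right_inv hzt⟩
    · exact indicator_of_notMem hzt _
  refine ⟨w, ?_, HasCompactSupport.intro hK hzero, fun z hz => indicator_of_notMem hz _, ?_⟩
  · refine continuous_iff_continuousAt.2 fun z => ?_
    by_cases hzt : z ∈ e.target
    · have h1 : ContinuousAt (v ∘ e.symm) z := hv.continuousAt.comp (e.continuousAt_symm hzt)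
      refine h1.congr ?_
      filter_upwards [e.open_target.mem_nhds hzt] with y hy
      rw [hw, indicator_of_mem hy]
    · have : z ∈ (e '' tsupport v)ᶜ := by
        rintro ⟨x, hx, rfl⟩
        exact hzt (e.map_source (hve hx))
      refine (continuousAt_const (y := (0 : ℝ≥0))).congr ?_
      filter_upwards [hK.isClosed.isOpen_compl.mem_nhds this] with y hy
      exact (hzero y hy).symm
  · intro x hx
    rw [hw, indicator_of_mem (e.map_source hx), Function.comp, e.left_inv hx]


variable {V : Type*} [NormedAddCommGroup V] [InnerProductSpace ℝ V] [FiniteDimensional ℝ V]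
  [MeasurableSpace V] [BorelSpace V]

variable {ι : Type*} {l : Filter ι} {ρ : ι → ℝ → ℝ≥0∞} {ζ : V → ℝ}

/-- Around a regular point, the straightening map compares the integrals over thin layers around
`{ζ = 0}` and the integral over `{ζ = 0}` with the corresponding integrals around a hyperplane. -/
lemma exists_nhds_nearLimit (h : IsApproxIdentity l ρ) (hζ : ContDiff ℝ 1 ζ) {x₀ : V}
    (hx₀ : ∇ ζ x₀ ≠ 0) {C : ℝ≥0} (hC : 1 < C) :
    ∃ U : Set V, IsOpen U ∧ x₀ ∈ U ∧ ∀ v : V → ℝ≥0, Continuous v → HasCompactSupport v →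
      tsupport v ⊆ U →
      NearLimit l C (fun i => ∫⁻ x, ρ i (ζ x) * (‖∇ ζ x‖ₑ * v x))
        (∫⁻ x in {x | ζ x = 0}, v x ∂μHE[finrank ℝ V - 1]) := by
  set d := finrank ℝ V with hd
  -- The factor `K ^ d` bounds the distortion of volumes and areas, the last one that of `‖∇ ζ‖`.
  obtain ⟨K, hK, hKC⟩ : ∃ K : ℝ≥0, 1 < K ∧ K ^ (d + 1) ≤ C := by
    have hcont : Tendsto (fun K : ℝ≥0 => K ^ (d + 1)) (𝓝[>] 1) (𝓝 1) := by
      have : Continuous fun K : ℝ≥0 => K ^ (d + 1) := by fun_prop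
      simpa using (this.tendsto 1).mono_left nhdsWithin_le_nhds
    have hself : ∀ᶠ K : ℝ≥0 in 𝓝[>] 1, 1 < K := self_mem_nhdsWithin
    obtain ⟨K, hK, hK1⟩ := ((hcont.eventually (gt_mem_nhds hC)).and hself).exists
    exact ⟨K, hK1, hK.le⟩
  have hKC' : (K : ℝ≥0∞) ^ (d + 1) ≤ C := by exact_mod_cast hKC
  have hK1 : (1 : ℝ≥0∞) ≤ K := by exact_mod_cast hK.le
  obtain ⟨e, n, c, hn, hc, hxe, he, hes, hex⟩ := exists_straightening hζ hx₀ hK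
  have hn0 : n ≠ 0 := by rintro rfl; simp at hn
  have hgm : Measurable fun x => ‖∇ ζ x‖ₑ := (continuous_gradient hζ).enorm.measurable
  have hζm : Measurable ζ := hζ.continuous.measurable
  refine ⟨e.source, e.open_source, hxe, fun v hv hvc hve => ?_⟩
  have hvm : Measurable fun x => (v x : ℝ≥0∞) := hv.measurable.coe_nnreal_ennreal
  have hv0 : ∀ x ∉ e.source, v x = 0 := fun x hx => by
    by_contra h0
    exact hx (hve (subset_tsupport _ h0))
  obtain ⟨w, hw, hwc, hw0, hwv⟩ := exists_transport e hv hvc hve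
  have hwm : Measurable fun x => (w x : ℝ≥0∞) := hw.measurable.coe_nnreal_ennreal
  have hwv' : ∀ z ∈ e.target, v (e.symm z) = w z := fun z hz => by
    rw [← hwv _ (e.map_target hz), e.right_inv hz]
  have hsm := e.open_source.measurableSet
  have htm := e.open_target.measurableSet
  have hvol : (μHE[d] : Measure V) = volume :=
    InnerProductSpace.euclideanHausdorffMeasure_eq_volume
  have hnin : Measurable fun z => ⟪n, z⟫ := by
    have : Continuous fun z => ⟪n, z⟫ := by fun_prop
    exact this.measurable
  have hflat := h.comp_mul_left hc
  refine ⟨fun i => ∫⁻ z, ENNReal.ofReal c * ρ i (c * ⟪n, z⟫) * w z,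
    ∫⁻ z in {z | ⟪n, z⟫ = 0}, w z ∂μHE[d - 1], lintegral_hyperplane_ne_top hn0 hw hwc,
    hflat.tendsto_hyperplane hn hw hwc, .of_forall fun i => ⟨?_, ?_⟩, ?_, ?_⟩
  · set q : V → ℝ≥0∞ := fun z => ENNReal.ofReal c * ρ i (c * ⟪n, z⟫) * w z with hq
    have hqm : Measurable q := ((hflat.measurable i).comp hnin).mul hwm
    have key := lintegral_comp_symm_le e.symm hes d (S := univ) (S' := univ) .univ
      (by simp) hqm
    simp only [OpenPartialHomeomorph.symm_source, OpenPartialHomeomorph.symm_target,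
      OpenPartialHomeomorph.symm_symm, inter_univ, hvol] at key
    calc ∫⁻ x, ρ i (ζ x) * (‖∇ ζ x‖ₑ * v x)
        = ∫⁻ x in e.source, ρ i (ζ x) * (‖∇ ζ x‖ₑ * v x) := by
          rw [← setLIntegral_univ, ← setLIntegral_inter_of_eq_zero hsm, inter_univ]
          intro x hx; simp [hv0 x hx]
      _ ≤ ∫⁻ x in e.source, K * q (e x) := by
          refine setLIntegral_mono_ae' hsm (.of_forall fun x hx => ?_)
          obtain ⟨h1, h2, -⟩ := hex x hx
          rw [hq]
          simp only
          rw [h1, hwv x hx]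
          have : ‖∇ ζ x‖ₑ ≤ K * ENNReal.ofReal c := by
            rw [← ofReal_norm, ← ENNReal.ofReal_coe_nnreal, ← ENNReal.ofReal_mul (by simp)]
            exact ENNReal.ofReal_le_ofReal h2
          calc _ ≤ ρ i (ζ x) * (K * ENNReal.ofReal c * v x) := by gcongr
            _ = _ := by ring
      _ = K * ∫⁻ x in e.source, q (e x) := lintegral_const_mul' _ _ ENNReal.coe_ne_top
      _ ≤ K * (K ^ d * ∫⁻ z in e.target, q z) := by gcongr
      _ = K ^ (d + 1) * ∫⁻ z in e.target, q z := by ring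
      _ ≤ C * ∫⁻ z, q z := by gcongr; exact Measure.restrict_le_self
  · have hpm : Measurable fun x => ENNReal.ofReal c * ρ i (ζ x) * v x :=
      (((h.measurable i).comp hζm).const_mul _).mul hvm
    have key := lintegral_comp_symm_le e he d (S := univ) (S' := univ) .univ (by simp) hpm
    simp only [inter_univ, hvol] at key
    calc ∫⁻ z, ENNReal.ofReal c * ρ i (c * ⟪n, z⟫) * w z
        = ∫⁻ z in e.target, ENNReal.ofReal c * ρ i (c * ⟪n, z⟫) * w z := by
          rw [← setLIntegral_univ, ← setLIntegral_inter_of_eq_zero htm, inter_univ]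
          intro x hx; simp [hw0 x hx]
      _ = ∫⁻ z in e.target, ENNReal.ofReal c * ρ i (ζ (e.symm z)) * v (e.symm z) := by
          refine setLIntegral_congr_fun htm fun z hz => ?_
          rw [hwv' z hz, ← (hex _ (e.map_target hz)).1, e.right_inv hz]
      _ ≤ K ^ d * ∫⁻ x in e.source, ENNReal.ofReal c * ρ i (ζ x) * v x := key
      _ ≤ K ^ d * ∫⁻ x in e.source, K * (ρ i (ζ x) * (‖∇ ζ x‖ₑ * v x)) := by
          gcongr 1
          refine setLIntegral_mono_ae' hsm (.of_forall fun x hx => ?_)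
          obtain ⟨-, -, h3⟩ := hex x hx
          have : ENNReal.ofReal c ≤ K * ‖∇ ζ x‖ₑ := by
            rw [← ofReal_norm, ← ENNReal.ofReal_coe_nnreal, ← ENNReal.ofReal_mul (by simp)]
            exact ENNReal.ofReal_le_ofReal h3
          calc _ ≤ K * ‖∇ ζ x‖ₑ * ρ i (ζ x) * v x := by gcongr
            _ = _ := by ring
      _ = K ^ d * (K * ∫⁻ x in e.source, ρ i (ζ x) * (‖∇ ζ x‖ₑ * v x)) := by
          rw [lintegral_const_mul' _ _ ENNReal.coe_ne_top]
      _ = K ^ (d + 1) * ∫⁻ x in e.source, ρ i (ζ x) * (‖∇ ζ x‖ₑ * v x) := by ring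
      _ ≤ C * ∫⁻ x, ρ i (ζ x) * (‖∇ ζ x‖ₑ * v x) := by gcongr; exact Measure.restrict_le_self
  -- The two estimates for the hypersurface itself.
  all_goals
    have hSm : MeasurableSet {x | ζ x = 0} := hζm (measurableSet_singleton 0)
    have hHm : MeasurableSet {z | ⟪n, z⟫ = 0} := hnin (measurableSet_singleton 0)
    have hiff : ∀ x ∈ e.source, e x ∈ {z | ⟪n, z⟫ = 0} ↔ x ∈ {x | ζ x = 0} := fun x hx => by
      simp only [mem_ofPred_eq]
      rw [← (hex x hx).1, mul_eq_zero, or_iff_right hc.ne']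
    have hKC'' : (K : ℝ≥0∞) ^ (d - 1) ≤ C :=
      (pow_le_pow_right₀ hK1 (by omega)).trans hKC'
  · have key := lintegral_comp_symm_le e.symm hes (d - 1) (S := {z | ⟪n, z⟫ = 0})
      (S' := {x | ζ x = 0}) hSm (fun z hz => by
        rw [← hiff _ (e.map_target hz)]
        simp only [OpenPartialHomeomorph.symm_source] at hz
        rw [e.right_inv hz]) hwm
    simp only [OpenPartialHomeomorph.symm_source, OpenPartialHomeomorph.symm_target,
      OpenPartialHomeomorph.symm_symm] at key
    rw [setLIntegral_inter_of_eq_zero htm (fun z hz => by simp [hw0 z hz])] at key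
    rw [← setLIntegral_inter_of_eq_zero hsm (fun z hz => by simp [hv0 z hz])]
    calc _ = ∫⁻ x in e.source ∩ {x | ζ x = 0}, w (e x) ∂μHE[d - 1] := by
          refine setLIntegral_congr_fun (hsm.inter hSm) fun z hz => ?_
          rw [hwv z hz.1]
      _ ≤ _ := key
      _ ≤ _ := by gcongr
  · have key := lintegral_comp_symm_le e he (d - 1) (S := {x | ζ x = 0})
      (S' := {z | ⟪n, z⟫ = 0}) hHm hiff hvm
    rw [setLIntegral_inter_of_eq_zero hsm (fun z hz => by simp [hv0 z hz])] at key
    rw [← setLIntegral_inter_of_eq_zero htm (fun z hz => by simp [hw0 z hz])]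
    calc _ = ∫⁻ z in e.target ∩ {z | ⟪n, z⟫ = 0}, v (e.symm z) ∂μHE[d - 1] := by
          refine setLIntegral_congr_fun (htm.inter hHm) fun z hz => ?_
          rw [hwv' z hz.1]
      _ ≤ _ := key
      _ ≤ _ := by gcongr

lemma nearLimit_of_tsupport_subset_compl (h : IsApproxIdentity l ρ) (hζ : Continuous ζ)
    (C : ℝ≥0∞) {v : V → ℝ≥0} (hvc : HasCompactSupport v) (hv : tsupport v ⊆ {x | ζ x = 0}ᶜ) :
    NearLimit l C (fun i => ∫⁻ x, ρ i (ζ x) * (‖∇ ζ x‖ₑ * v x))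
      (∫⁻ x in {x | ζ x = 0}, v x ∂μHE[finrank ℝ V - 1]) := by
  have hv0 : ∀ x ∉ tsupport v, v x = 0 := fun x hx => image_eq_zero_of_notMem_tsupport hx
  refine .of_eventually_eq_zero ?_ ?_
  · obtain ⟨r, hr, hrv⟩ : ∃ r, 0 < r ∧ ∀ x ∈ tsupport v, r ≤ |ζ x| :=
      hvc.isCompact.exists_forall_le' hζ.abs.continuousOn
        fun x hx => abs_pos.2 (hv hx)
    filter_upwards [h.eventually_eq_zero r hr] with i hi
    rw [lintegral_eq_zero_of_ae_eq_zero]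
    refine .of_forall fun x => ?_
    by_cases hx : x ∈ tsupport v
    · simp [hi _ (hrv x hx)]
    · simp [hv0 x hx]
  · rw [← lintegral_zero (μ := (μHE[finrank ℝ V - 1] : Measure V).restrict {x | ζ x = 0})]
    refine setLIntegral_congr_fun (hζ.measurable (measurableSet_singleton 0)) fun x hx => ?_
    have : x ∉ tsupport v := fun h => hv h hx
    simp [hv0 x this]

/-- The local estimates around the points of the level set, glued by a partition of unity. -/
lemma nearLimit_levelSet (h : IsApproxIdentity l ρ) (hζ : ContDiff ℝ 1 ζ) {u : V → ℝ≥0}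
    (hu : Continuous u) (huc : HasCompactSupport u)
    (hreg : ∀ x ∈ tsupport u, ζ x = 0 → ∇ ζ x ≠ 0) {C : ℝ≥0} (hC : 1 < C) :
    NearLimit l C (fun i => ∫⁻ x, ρ i (ζ x) * (‖∇ ζ x‖ₑ * u x))
      (∫⁻ x in {x | ζ x = 0}, u x ∂μHE[finrank ℝ V - 1]) := by
  have hloc : ∀ x : V, ∃ U : Set V, x ∈ tsupport u → IsOpen U ∧ x ∈ U ∧ ∀ v : V → ℝ≥0,
      Continuous v → HasCompactSupport v → tsupport v ⊆ U →
      NearLimit l C (fun i => ∫⁻ x, ρ i (ζ x) * (‖∇ ζ x‖ₑ * v x))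
        (∫⁻ x in {x | ζ x = 0}, v x ∂μHE[finrank ℝ V - 1]) := by
    intro x
    by_cases hx : x ∈ tsupport u
    swap
    · exact ⟨univ, fun h => absurd h hx⟩
    by_cases hx0 : ζ x = 0
    · obtain ⟨U, h1, h2, h3⟩ := exists_nhds_nearLimit h hζ (hreg x hx hx0) hC
      exact ⟨U, fun _ => ⟨h1, h2, h3⟩⟩
    · exact ⟨{x | ζ x = 0}ᶜ, fun _ => ⟨(isClosed_singleton.preimage hζ.continuous).isOpen_compl,
        hx0, fun v _ hvc hv => nearLimit_of_tsupport_subset_compl h hζ.continuous C hvc hv⟩⟩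
  choose U hU using hloc
  obtain ⟨t, htu, ht⟩ := huc.isCompact.elim_nhds_subcover U
    fun x hx => (hU x hx).1.mem_nhds (hU x hx).2.1
  obtain ⟨f, hfU, hf1, hf01, hfc⟩ := exists_continuous_sum_one_of_isOpen_isCompact
    (s := fun j : Fin t.card => U (t.equivFin.symm j))
    (fun j => (hU _ (htu _ (t.equivFin.symm j).2)).1) huc.isCompact (by
      intro x hx
      obtain ⟨y, hy, hxy⟩ := mem_iUnion₂.1 (ht hx)
      exact mem_iUnion.2 ⟨t.equivFin ⟨y, hy⟩, by simpa using hxy⟩)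
  set v : Fin t.card → V → ℝ≥0 := fun j x => (f j x).toNNReal * u x with hv
  have hvs : ∀ j, tsupport (v j) ⊆ tsupport (f j) := fun j => by
    refine closure_mono fun x hx hfx => hx ?_
    simp [hv, hfx]
  have hvcont : ∀ j, Continuous (v j) := fun j =>
    (continuous_real_toNNReal.comp (f j).continuous).mul hu
  have hvu : ∀ x, ∑ j, v j x = u x := fun x => by
    rw [hv, ← Finset.sum_mul]
    by_cases hx : x ∈ tsupport u
    · rw [← Real.toNNReal_sum_of_nonneg fun j _ => (hf01 j x).1]
      have : ∑ j, f j x = 1 := by simpa using hf1 hx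
      rw [this, Real.toNNReal_one, one_mul]
    · rw [image_eq_zero_of_notMem_tsupport hx, mul_zero]
  have hvm : ∀ j, Measurable fun x => (v j x : ℝ≥0∞) :=
    fun j => (hvcont j).measurable.coe_nnreal_ennreal
  have key := NearLimit.sum Finset.univ fun j _ => (hU _ (htu _ (t.equivFin.symm j).2)).2.2 (v j)
    (hvcont j) ((hfc j).mono' ((subset_tsupport _).trans (hvs j))) ((hvs j).trans (hfU j))
  convert! key using 1
  · funext i
    rw [← lintegral_finsetSum]
    · refine lintegral_congr fun x => ?_
      rw [← Finset.mul_sum, ← Finset.mul_sum, ← hvu x]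
      push_cast
      rfl
    · intro j _
      exact ((h.measurable i).comp hζ.continuous.measurable).mul
        ((continuous_gradient hζ).enorm.measurable.mul (hvm j))
  · rw [← lintegral_finsetSum _ fun j _ => hvm j]
    refine lintegral_congr fun x => ?_
    rw [← hvu x]
    push_cast
    rfl

/-- A weak form of the coarea formula: the integrals of `u ‖∇ζ‖` over thin layers around a regular
level set converge to the integral of `u` against the surface measure. -/
theorem tendsto_integral_levelSet (h : IsApproxIdentity l ρ) (hζ : ContDiff ℝ 1 ζ)
    {u : V → ℝ} (hu : Continuous u) (huc : HasCompactSupport u)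
    (hreg : ∀ x ∈ tsupport u, ζ x = 0 → ∇ ζ x ≠ 0) {η : ι → ℝ → ℝ} (hη : ∀ i, Continuous (η i))
    (hη0 : ∀ i t, 0 ≤ η i t) (hρ : ∀ i t, ρ i t = ENNReal.ofReal (η i t)) :
    Tendsto (fun i => ∫ x, η i (ζ x) * (‖∇ ζ x‖ * u x)) l
      (𝓝 (∫ x in {x | ζ x = 0}, u x ∂μHE[finrank ℝ V - 1])) := by
  -- The estimates concern nonnegative functions: `w` is to be `u` or `-u`, truncated by `ofReal`.
  have hpart : ∀ w : V → ℝ, Continuous w → (∀ x, u x = 0 → w x = 0) →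
      Tendsto (fun i => ENNReal.toReal (∫⁻ x, ENNReal.ofReal (η i (ζ x) * (‖∇ ζ x‖ * w x)))) l
        (𝓝 (ENNReal.toReal
          (∫⁻ x in {x | ζ x = 0}, ENNReal.ofReal (w x) ∂μHE[finrank ℝ V - 1]))) ∧
      ∫⁻ x in {x | ζ x = 0}, ENNReal.ofReal (w x) ∂μHE[finrank ℝ V - 1] ≠ ⊤ := by
    intro w hw hwu
    have hsub : tsupport (fun x => (w x).toNNReal) ⊆ tsupport u := by
      refine closure_mono fun x hx h0 => hx ?_
      simp [hwu x h0]
    have hN : ∀ C : ℝ≥0, 1 < C → _ := fun C hC => nearLimit_levelSet h hζ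
      (continuous_real_toNNReal.comp hw) (huc.mono' ((subset_tsupport _).trans hsub))
      (fun x hx => hreg x (hsub hx)) hC
    have htop := (hN 2 one_lt_two).ne_top ENNReal.coe_ne_top
    refine ⟨((ENNReal.tendsto_toReal htop).comp (tendsto_of_nearLimit hN)).congr fun i => ?_,
      htop⟩
    simp only [Function.comp]
    congr 1
    refine lintegral_congr fun x => ?_
    rw [ENNReal.ofReal_mul (hη0 i _), ENNReal.ofReal_mul (norm_nonneg _), ofReal_norm, hρ]
    rfl
  obtain ⟨hp, hpt⟩ := hpart u hu fun _ h => h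
  obtain ⟨hm, hmt⟩ := hpart (fun x => -u x) hu.neg fun x h => by simp [h]
  have hI : Integrable u (μHE[finrank ℝ V - 1].restrict {x | ζ x = 0}) := by
    refine ⟨hu.aestronglyMeasurable, ?_⟩
    rw [hasFiniteIntegral_iff_norm]
    have : ∀ x, ENNReal.ofReal ‖u x‖ = ENNReal.ofReal (u x) + ENNReal.ofReal (-u x) := fun x => by
      rcases le_total 0 (u x) with hx | hx
      · simp [abs_of_nonneg hx, ENNReal.ofReal_of_nonpos (neg_nonpos.2 hx)]
      · simp [abs_of_nonpos hx, ENNReal.ofReal_of_nonpos hx]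
    simp_rw [this]
    rw [lintegral_add_left (by fun_prop)]
    exact ENNReal.add_lt_top.2 ⟨hpt.lt_top, hmt.lt_top⟩
  rw [integral_eq_lintegral_pos_part_sub_lintegral_neg_part hI]
  refine (hp.sub hm).congr fun i => ?_
  rw [integral_eq_lintegral_pos_part_sub_lintegral_neg_part]
  · simp only [mul_neg]
  · refine Continuous.integrable_of_hasCompactSupport
      (((hη i).comp hζ.continuous).mul ((continuous_gradient hζ).norm.mul hu)) ?_
    exact (huc.mul_left (f := fun x => ‖∇ ζ x‖)).mul_left

/-- Normalised smooth bumps on the line, with supports shrinking to the origin. -/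
noncomputable def shrinkingBump (k : ℕ) : ContDiffBump (0 : ℝ) where
  rIn := 1 / (k + 2)
  rOut := 1 / (k + 1)
  rIn_pos := by positivity
  rIn_lt_rOut := by
    apply one_div_lt_one_div_of_lt <;> [positivity; linarith]

lemma isApproxIdentity_shrinkingBump :
    IsApproxIdentity atTop fun k t => ENNReal.ofReal ((shrinkingBump k).normed volume t) where
  measurable k := (shrinkingBump k).continuous_normed.measurable.ennreal_ofReal
  lintegral_eq_one k := by
    rw [← ofReal_integral_eq_lintegral_ofReal (shrinkingBump k).integrable_normed
      (.of_forall (shrinkingBump k).nonneg_normed), (shrinkingBump k).integral_normed,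
      ENNReal.ofReal_one]
  eventually_eq_zero r hr := by
    have := tendsto_one_div_add_atTop_nhds_zero_nat (𝕜 := ℝ)
    filter_upwards [this.eventually (gt_mem_nhds hr)] with k hk t ht
    have : t ∉ Function.support ((shrinkingBump k).normed volume) := by
      rw [(shrinkingBump k).support_normed_eq]
      simp only [shrinkingBump, Metric.mem_ball, dist_zero_right, Real.norm_eq_abs, not_lt]
      linarith
    rw [Function.notMem_support.1 this, ENNReal.ofReal_zero]

lemma levelSet_measure_lt_top (hζ : ContDiff ℝ 1 ζ) (hM : IsCompact {x | ζ x = 0})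
    (hreg : ∀ x, ζ x = 0 → ∇ ζ x ≠ 0) :
    (μHE[finrank ℝ V - 1] : Measure V) {x | ζ x = 0} < ⊤ := by
  obtain ⟨f, hf1, -, hfc, -⟩ := exists_continuous_one_zero_of_isCompact hM
    (isClosed_empty) (disjoint_empty _)
  have h := nearLimit_levelSet isApproxIdentity_shrinkingBump hζ
    (continuous_real_toNNReal.comp f.continuous) (hfc.comp_left Real.toNNReal_zero)
    (fun x _ => hreg x) one_lt_two
  refine lt_of_le_of_lt ?_ (h.ne_top ENNReal.coe_ne_top).lt_top
  rw [← setLIntegral_one]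
  refine setLIntegral_mono_ae' hM.measurableSet (.of_forall fun x hx => ?_)
  simp [hf1 hx]

lemma levelSet_measure_pos (hζ : ContDiff ℝ 1 ζ) {x₀ : V} (hx₀ : ζ x₀ = 0)
    (hreg : ∇ ζ x₀ ≠ 0) :
    0 < (μHE[finrank ℝ V - 1] : Measure V) {x | ζ x = 0} := by
  obtain ⟨e, n, c, hn, hc, hxe, he, -, hex⟩ := exists_straightening hζ hreg one_lt_two
  have hn0 : n ≠ 0 := by rintro rfl; simp at hn
  have hHm : MeasurableSet {z | ⟪n, z⟫ = 0} := by
    have : Continuous fun z => ⟪n, z⟫ := by fun_prop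
    exact this.measurable (measurableSet_singleton 0)
  have hmem : ∀ x ∈ e.source, e x ∈ {z | ⟪n, z⟫ = 0} ↔ x ∈ {x | ζ x = 0} := fun x hx => by
    simp only [mem_ofPred_eq]
    rw [← (hex x hx).1, mul_eq_zero, or_iff_right hc.ne']
  have key := lintegral_comp_symm_le e he (finrank ℝ V - 1) (S := {x | ζ x = 0})
    (S' := {z | ⟪n, z⟫ = 0}) hHm hmem (f := fun _ => 1) measurable_const
  rw [setLIntegral_one, setLIntegral_one] at key
  have hpos : 0 < (μHE[finrank ℝ V - 1] : Measure V) (e.target ∩ {z | ⟪n, z⟫ = 0}) := by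
    rw [← Measure.restrict_apply e.open_target.measurableSet, ← map_orthogonal_singleton hn0,
      Measure.map_apply measurable_subtype_coe e.open_target.measurableSet]
    refine (e.open_target.preimage continuous_subtype_val).measure_pos _ ?_
    exact ⟨⟨e x₀, Submodule.mem_orthogonal_singleton_iff_inner_right.2
      ((hmem x₀ hxe).2 hx₀)⟩, e.map_source hxe⟩
  have h2 := hpos.trans_le key
  by_contra h0
  have : (μHE[finrank ℝ V - 1] : Measure V) (e.source ∩ {x | ζ x = 0}) = 0 :=
    measure_mono_null inter_subset_right (by simpa using h0)
  simp [this] at h2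

end Coarea

/-! ### Calculus of the tangential divergence -/

section Calculus

variable {d : ℕ} {ζ φ : EuclideanSpace ℝ (Fin d) → ℝ}
  {H W Y Z : EuclideanSpace ℝ (Fin d) → EuclideanSpace ℝ (Fin d)} {x : EuclideanSpace ℝ (Fin d)}

/-- The divergence theorem on `ℝ^d` for compactly supported fields. -/
lemma integral_div_eq_zero (hZ : ContDiff ℝ 1 Z) (hZc : HasCompactSupport Z) :
    ∫ x, div Z x = 0 := by
  have hcomp (i : Fin d) : ContDiff ℝ 1 fun x => Z x i := contDiff_euclidean.1 hZ i
  have hcc (i : Fin d) : HasCompactSupport fun x => Z x i :=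
    hZc.comp_left (g := fun v : EuclideanSpace ℝ (Fin d) => v i) rfl
  have hfd (i : Fin d) (x : EuclideanSpace ℝ (Fin d)) :
      (fderiv ℝ Z x (EuclideanSpace.single i 1)) i =
        fderiv ℝ (fun x => Z x i) x (EuclideanSpace.single i 1) := by
    have h1 := (EuclideanSpace.proj (𝕜 := ℝ) i).hasFDerivAt.comp x
      ((hZ.differentiable one_ne_zero).differentiableAt (x := x)).hasFDerivAt
    have h2 : HasFDerivAt (fun x => Z x i) _ x := h1
    rw [h2.fderiv]
    rfl
  have hint (i : Fin d) : Integrable fun x =>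
      fderiv ℝ (fun x => Z x i) x (EuclideanSpace.single i 1) := by
    refine Continuous.integrable_of_hasCompactSupport ?_ ?_
    · exact ((hcomp i).continuous_fderiv one_ne_zero).clm_apply continuous_const
    · exact (hcc i).fderiv_apply (𝕜 := ℝ) _
  simp_rw [div, hfd]
  rw [integral_finsetSum _ fun i _ => hint i]
  refine Finset.sum_eq_zero fun i _ => ?_
  -- Integration by parts against the constant function `1`.
  have := integral_mul_fderiv_eq_neg_fderiv_mul_of_integrable
    (μ := (volume : Measure (EuclideanSpace ℝ (Fin d))))
    (f := fun _ => (1 : ℝ)) (g := fun x => Z x i) (v := EuclideanSpace.single i 1)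
    (by simp) (by simpa using hint i)
    (by simpa using (hcomp i).continuous.integrable_of_hasCompactSupport (hcc i))
    (by simp) fun x _ => (hcomp i).differentiable one_ne_zero x
  simpa using this

lemma inner_tangentGrad (ζ ψ : EuclideanSpace ℝ (Fin d) → ℝ) (x v : EuclideanSpace ℝ (Fin d)) :
    ⟪tangentGrad ζ ψ x, v⟫ =
      fderiv ℝ ψ x v - (gram ζ x)⁻¹ * ⟪∇ ζ x, v⟫ * fderiv ℝ ψ x (∇ ζ x) := by
  rw [tangentGrad, tangentProj, inner_sub_left, inner_smul_left, inner_gradient_left,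
    real_inner_comm, inner_gradient_left]
  simp
  ring

lemma div_smul (hφ : DifferentiableAt ℝ φ x) (hZ : DifferentiableAt ℝ Z x) :
    div (fun y => φ y • Z y) x = φ x * div Z x + fderiv ℝ φ x (Z x) := by
  have h1 : fderiv ℝ φ x (Z x) =
      ∑ i, Z x i * fderiv ℝ φ x (EuclideanSpace.single i 1) := by
    conv_lhs => rw [← (EuclideanSpace.basisFun (Fin d) ℝ).sum_repr (Z x)]
    simp
  rw [div, fderiv_fun_smul hφ hZ, h1, div, Finset.mul_sum, ← Finset.sum_add_distrib]
  refine Finset.sum_congr rfl fun i _ => ?_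
  simp
  ring

lemma div_sub (hY : DifferentiableAt ℝ Y x) (hZ : DifferentiableAt ℝ Z x) :
    div (fun y => Y y - Z y) x = div Y x - div Z x := by
  rw [div, fderiv_fun_sub hY hZ, div, div, ← Finset.sum_sub_distrib]
  rfl

lemma tangentDiv_smul (hφ : DifferentiableAt ℝ φ x) (hZ : DifferentiableAt ℝ Z x) :
    tangentDiv ζ (fun y => φ y • Z y) x =
      φ x * tangentDiv ζ Z x + ⟪tangentGrad ζ φ x, Z x⟫ := by
  rw [tangentDiv, div_smul hφ hZ, fderiv_fun_smul hφ hZ, tangentDiv, inner_tangentGrad]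
  simp [inner_add_right, inner_smul_right]
  ring

lemma tangentDiv_sub (hY : DifferentiableAt ℝ Y x) (hZ : DifferentiableAt ℝ Z x) :
    tangentDiv ζ (fun y => Y y - Z y) x = tangentDiv ζ Y x - tangentDiv ζ Z x := by
  rw [tangentDiv, div_sub hY hZ, fderiv_fun_sub hY hZ, tangentDiv, tangentDiv,
    _root_.sub_apply, inner_sub_right]
  ring

lemma _root_.Filter.EventuallyEq.tangentDiv_eq (h : Y =ᶠ[𝓝 x] Z) :
    tangentDiv ζ Y x = tangentDiv ζ Z x := by
  rw [tangentDiv, tangentDiv, div, div, h.fderiv_eq]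

lemma inner_gradient_tangentProj (hG : gram ζ x ≠ 0) (v : EuclideanSpace ℝ (Fin d)) :
    ⟪∇ ζ x, tangentProj ζ x v⟫ = 0 := by
  rw [tangentProj, inner_sub_right, inner_smul_right, ← gram]
  field_simp
  ring

lemma inner_tangentGrad_tangentProj (hG : gram ζ x ≠ 0) (ψ : EuclideanSpace ℝ (Fin d) → ℝ)
    (v : EuclideanSpace ℝ (Fin d)) :
    ⟪tangentGrad ζ ψ x, tangentProj ζ x v⟫ = ⟪tangentGrad ζ ψ x, v⟫ := by
  conv_lhs => rw [tangentProj]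
  rw [inner_sub_right, inner_smul_right, inner_tangentGrad ζ ψ x (∇ ζ x), ← gram]
  field_simp
  ring

lemma contDiff_gradient (hζ : ContDiff ℝ ∞ ζ) : ContDiff ℝ ∞ (∇ ζ) :=
  (InnerProductSpace.toDual ℝ (EuclideanSpace ℝ (Fin d))).symm.contDiff.comp
    (hζ.fderiv_right le_rfl)

lemma contDiff_gram (hζ : ContDiff ℝ ∞ ζ) : ContDiff ℝ ∞ (gram ζ) :=
  (contDiff_gradient hζ).inner ℝ (contDiff_gradient hζ)

lemma contDiffAt_normalCoeff (hζ : ContDiff ℝ ∞ ζ) (hG : gram ζ x ≠ 0)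
    (hH : ContDiffAt ℝ 1 H x) :
    ContDiffAt ℝ 1 (fun y => (gram ζ y)⁻¹ * ⟪∇ ζ y, H y⟫) x :=
  (((contDiff_gram hζ).of_le (by simp)).contDiffAt.inv hG).mul
    (((contDiff_gradient hζ).of_le (by simp)).contDiffAt.inner ℝ hH)

lemma contDiffAt_tangentProj (hζ : ContDiff ℝ ∞ ζ) (hG : gram ζ x ≠ 0)
    (hH : ContDiffAt ℝ 1 H x) : ContDiffAt ℝ 1 (fun y => tangentProj ζ y (H y)) x :=
  hH.sub ((contDiffAt_normalCoeff hζ hG hH).smul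
    ((contDiff_gradient hζ).of_le (by simp)).contDiffAt)

/-- Removing the normal part `q ∇ζ` of a field changes its tangential divergence by
`q tangentDiv ζ (∇ζ)`: there is no term with the derivatives of `q`, since `∇_M q` is orthogonal to
`∇ζ`. -/
lemma tangentDiv_tangentProj (hζ : ContDiff ℝ ∞ ζ) (hG : gram ζ x ≠ 0)
    (hH : ContDiffAt ℝ 1 H x) :
    tangentDiv ζ (fun y => tangentProj ζ y (H y)) x =
      tangentDiv ζ H x - (gram ζ x)⁻¹ * ⟪∇ ζ x, H x⟫ * tangentDiv ζ (∇ ζ) x := by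
  have hq := (contDiffAt_normalCoeff hζ hG hH).differentiableAt one_ne_zero
  have hg := ((contDiff_gradient hζ).differentiable (by simp)).differentiableAt (x := x)
  have h1 := tangentDiv_sub (ζ := ζ) (hH.differentiableAt one_ne_zero) (hq.smul hg)
  have h2 := tangentDiv_smul (ζ := ζ) hq hg
  have h3 (φ : EuclideanSpace ℝ (Fin d) → ℝ) : ⟪tangentGrad ζ φ x, ∇ ζ x⟫ = 0 := by
    rw [real_inner_comm, tangentGrad, inner_gradient_tangentProj hG]
  rw [h3, add_zero] at h2
  simp only [tangentProj]
  rw [← h2]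
  exact h1

lemma continuousAt_tangentDiv (hζ : ContDiff ℝ ∞ ζ) (hG : gram ζ x ≠ 0)
    (hH : ContDiffAt ℝ 1 H x) : ContinuousAt (tangentDiv ζ H) x := by
  have h1 : ContinuousAt (fderiv ℝ H) x :=
    (hH.fderiv_right (m := 0) (by simp)).continuousAt
  have hg : ContinuousAt (∇ ζ) x := (contDiff_gradient hζ).continuous.continuousAt
  have hGr : ContinuousAt (gram ζ) x := (contDiff_gram hζ).continuous.continuousAt
  have hdiv : ContinuousAt (div H) x := by
    refine tendsto_finsetSum _ fun i _ => ?_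
    exact ((EuclideanSpace.proj (𝕜 := ℝ) i).continuous.continuousAt (x := _)).comp
      (f := fun y => fderiv ℝ H y (EuclideanSpace.single i 1)) (h1.clm_apply continuousAt_const)
  exact hdiv.sub ((hGr.inv₀ hG).mul (hg.inner (h1.clm_apply hg)))

/-- The derivative of the gradient is self-adjoint. -/
lemma inner_fderiv_gradient_comm (hζ : ContDiff ℝ ∞ ζ) (x v w : EuclideanSpace ℝ (Fin d)) :
    ⟪fderiv ℝ (∇ ζ) x v, w⟫ = ⟪v, fderiv ℝ (∇ ζ) x w⟫ := by
  have hd : DifferentiableAt ℝ (fderiv ℝ ζ) x :=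
    ((hζ.fderiv_right (m := ∞) le_rfl).differentiable (by simp)).differentiableAt
  have h1 (u : EuclideanSpace ℝ (Fin d)) : fderiv ℝ (∇ ζ) x u =
      (InnerProductSpace.toDual ℝ (EuclideanSpace ℝ (Fin d))).symm (fderiv ℝ (fderiv ℝ ζ) x u) := by
    have := ((InnerProductSpace.toDual ℝ (EuclideanSpace ℝ (Fin d))).symm.toContinuousLinearEquiv :
      _ ≃L[ℝ] EuclideanSpace ℝ (Fin d)).hasFDerivAt.comp x hd.hasFDerivAt
    have h2 : HasFDerivAt (∇ ζ) _ x := this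
    rw [h2.fderiv]
    rfl
  have hs : IsSymmSndFDerivAt ℝ ζ x := hζ.contDiffAt.isSymmSndFDerivAt (by
    rw [minSmoothness_of_isRCLikeNormedField]
    exact WithTop.coe_le_coe.2 (le_top : (2 : ℕ∞) ≤ ⊤))
  rw [h1, h1, InnerProductSpace.toDual_symm_apply, real_inner_comm,
    InnerProductSpace.toDual_symm_apply, hs.eq]

/-- The weight `‖∇ζ‖` of the coarea formula turns the divergence of a field tangent to the level
sets of `ζ` into the tangential divergence. -/
lemma div_norm_gradient_smul (hζ : ContDiff ℝ ∞ ζ) (hW : ContDiff ℝ 1 W)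
    (hWt : ∀ x, ⟪∇ ζ x, W x⟫ = 0) (hx : ∇ ζ x ≠ 0) :
    div (fun y => ‖∇ ζ y‖ • W y) x = ‖∇ ζ x‖ * tangentDiv ζ W x := by
  have hg := ((contDiff_gradient hζ).differentiable (by simp)).differentiableAt (x := x)
  have hWd := (hW.differentiable one_ne_zero).differentiableAt (x := x)
  have hn : ‖∇ ζ x‖ ≠ 0 := norm_ne_zero_iff.2 hx
  have hnorm : DifferentiableAt ℝ (fun y => ‖∇ ζ y‖) x := hg.norm ℝ hx
  -- Differentiating `⟪∇ζ, W⟫ = 0` in the direction `∇ζ`.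
  have h1 : ⟪∇ ζ x, fderiv ℝ W x (∇ ζ x)⟫ + ⟪fderiv ℝ (∇ ζ) x (∇ ζ x), W x⟫ = 0 := by
    rw [← fderiv_inner_apply ℝ hg hWd]
    simp [hWt]
  have h2 : ‖∇ ζ x‖ * fderiv ℝ (fun y => ‖∇ ζ y‖) x (W x) =
      ⟪∇ ζ x, fderiv ℝ (∇ ζ) x (W x)⟫ := by
    have h3 : (fun y => ‖∇ ζ y‖ * ‖∇ ζ y‖) = fun y => ⟪∇ ζ y, ∇ ζ y⟫ := by
      funext y; rw [real_inner_self_eq_norm_mul_norm]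
    have h4 := congrArg (fun F => fderiv ℝ F x (W x)) h3
    rw [fderiv_inner_apply ℝ hg hg, fderiv_fun_mul hnorm hnorm, real_inner_comm (∇ ζ x)] at h4
    simp at h4
    rw [inner_gradient_left]
    linarith
  rw [inner_fderiv_gradient_comm hζ] at h1
  have h5 : gram ζ x = ‖∇ ζ x‖ * ‖∇ ζ x‖ := real_inner_self_eq_norm_mul_norm _
  rw [div_smul hnorm hWd, tangentDiv, h5]
  have h6 : fderiv ℝ (fun y => ‖∇ ζ y‖) x (W x) =
      -‖∇ ζ x‖⁻¹ * ⟪∇ ζ x, fderiv ℝ W x (∇ ζ x)⟫ := by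
    field_simp
    linarith
  rw [h6]
  field_simp
  ring

end Calculus

/-! ### The divergence theorem on a compact level set -/

section Divergence

variable {d : ℕ} {ζ : EuclideanSpace ℝ (Fin d) → ℝ}

lemma contDiff_of_forall_mem_tsupport {F F' : Type*} [NormedAddCommGroup F] [NormedSpace ℝ F]
    [NormedAddCommGroup F'] [NormedSpace ℝ F'] {n : ℕ∞ω} {f : F → F'}
    (hf : ∀ x ∈ tsupport f, ContDiffAt ℝ n f x) : ContDiff ℝ n f := by
  refine contDiff_iff_contDiffAt.2 fun x => ?_
  by_cases hx : x ∈ tsupport f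
  · exact hf x hx
  · exact contDiffAt_const.congr_of_eventuallyEq (notMem_tsupport_iff_eventuallyEq.1 hx)

lemma tangentDiv_eq_zero_of_notMem_tsupport
    {W : EuclideanSpace ℝ (Fin d) → EuclideanSpace ℝ (Fin d)} {x : EuclideanSpace ℝ (Fin d)}
    (hx : x ∉ tsupport W) : tangentDiv ζ W x = 0 := by
  have := (notMem_tsupport_iff_eventuallyEq.1 hx).fderiv_eq (𝕜 := ℝ)
  simp [tangentDiv, div, this]

/-- The integral of `div (η(ζ) ‖∇ζ‖ W) = η(ζ) ‖∇ζ‖ tangentDiv ζ W` over `ℝ^d` vanishes, and it tends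
to the integral of `tangentDiv ζ W` over the hypersurface when `η` shrinks to the origin. -/
theorem integral_tangentDiv_eq_zero_of_hasCompactSupport (hζ : ContDiff ℝ ∞ ζ)
    {W : EuclideanSpace ℝ (Fin d) → EuclideanSpace ℝ (Fin d)} (hW : ContDiff ℝ 1 W)
    (hWc : HasCompactSupport W) (hWt : ∀ x, ⟪∇ ζ x, W x⟫ = 0)
    (hreg : ∀ x ∈ tsupport W, ∇ ζ x ≠ 0) :
    ∫ x, tangentDiv ζ W x ∂surfaceMeasure ζ = 0 := by
  have hgram : ∀ x, ∇ ζ x ≠ 0 → gram ζ x ≠ 0 := fun x hx => inner_self_ne_zero.2 hx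
  set Z : EuclideanSpace ℝ (Fin d) → EuclideanSpace ℝ (Fin d) := fun y => ‖∇ ζ y‖ • W y with hZ
  have hZW : tsupport Z ⊆ tsupport W := closure_mono fun x hx h => hx (by simp [hZ, h])
  have hZ1 : ContDiff ℝ 1 Z := contDiff_of_forall_mem_tsupport fun x hx =>
    (((contDiff_gradient hζ).of_le (by simp)).contDiffAt.norm ℝ (hreg x (hZW hx))).smul
      hW.contDiffAt
  have hdivZ : ∀ x, div Z x = ‖∇ ζ x‖ * tangentDiv ζ W x := fun x => by
    by_cases hx : ∇ ζ x = 0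
    · have hxW : x ∉ tsupport Z := fun h => hreg x (hZW h) hx
      have := (notMem_tsupport_iff_eventuallyEq.1 hxW).fderiv_eq (𝕜 := ℝ)
      simp [div, this, hx]
    · exact div_norm_gradient_smul hζ hW hWt hx
  have hu0 : ∀ x ∉ tsupport W, tangentDiv ζ W x = 0 :=
    fun x hx => tangentDiv_eq_zero_of_notMem_tsupport hx
  have husub : tsupport (tangentDiv ζ W) ⊆ tsupport W :=
    closure_minimal (fun x hx => by_contra fun h => hx (hu0 x h)) (isClosed_tsupport W)
  have hu : Continuous (tangentDiv ζ W) := continuous_of_tsupport fun x hx =>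
    continuousAt_tangentDiv hζ (hgram x (hreg x (husub hx))) hW.contDiffAt
  have huc : HasCompactSupport (tangentDiv ζ W) := hWc.mono' ((subset_tsupport _).trans husub)
  have hζ1 : ContDiff ℝ 1 ζ := hζ.of_le (by simp)
  have key := tendsto_integral_levelSet isApproxIdentity_shrinkingBump hζ1 hu huc
    (fun x hx _ => hreg x (husub hx)) (fun k => (shrinkingBump k).continuous_normed)
    (fun k => (shrinkingBump k).nonneg_normed) (fun _ _ => rfl)
  rw [finrank_euclideanSpace_fin] at key
  refine tendsto_nhds_unique key ?_
  refine tendsto_const_nhds.congr fun k => ?_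
  have hη : ContDiff ℝ 1 ((shrinkingBump k).normed volume) := (shrinkingBump k).contDiff_normed
  have hηζ : ContDiff ℝ 1 fun x => (shrinkingBump k).normed volume (ζ x) := hη.comp hζ1
  refine (integral_div_eq_zero (hηζ.smul hZ1) (HasCompactSupport.smul_left
    (hWc.mono' ((subset_tsupport _).trans hZW)))).symm.trans ?_
  refine integral_congr_ae (.of_forall fun x => ?_)
  -- The factor `η(ζ)` is constant along `Z`, which is tangent to the level sets.
  have h1 : fderiv ℝ (fun x => (shrinkingBump k).normed volume (ζ x)) x (Z x) = 0 := by
    have h2 := ((hη.differentiable one_ne_zero _).hasFDerivAt).comp x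
      (hζ1.differentiable one_ne_zero x).hasFDerivAt
    have h3 : HasFDerivAt (fun x => (shrinkingBump k).normed volume (ζ x)) _ x := h2
    have h4 : fderiv ℝ ζ x (Z x) = 0 := by
      rw [← inner_gradient_left, hZ, inner_smul_right, hWt, mul_zero]
    rw [h3.fderiv, ContinuousLinearMap.comp_apply, h4, map_zero]
  have h5 := div_smul (hηζ.differentiable one_ne_zero x) (hZ1.differentiable one_ne_zero x)
  rw [h1, add_zero, hdivZ] at h5
  exact h5

lemma exists_cutoff {M O : Set (EuclideanSpace ℝ (Fin d))} (hM : IsCompact M) (hO : IsOpen O)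
    (hMO : M ⊆ O) : ∃ χ : EuclideanSpace ℝ (Fin d) → ℝ, ContDiff ℝ ∞ χ ∧ HasCompactSupport χ ∧
      tsupport χ ⊆ O ∧ ∀ x ∈ M, χ =ᶠ[𝓝 x] 1 := by
  obtain ⟨t, ht, hMt, htO⟩ := exists_compact_between hM hO hMO
  obtain ⟨f, hf1, hf0, -⟩ := exists_contMDiffMap_one_nhds_of_subset_interior (n := ⊤)
    (modelWithCornersSelf ℝ (EuclideanSpace ℝ (Fin d))) hM.isClosed hMt
  have hsub : tsupport f ⊆ t :=
    closure_minimal (fun x hx => by_contra fun h => hx (hf0 x h)) ht.isClosed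
  exact ⟨f, f.contMDiff.contDiff, ht.of_isClosed_subset (isClosed_tsupport _) hsub, hsub.trans htO,
    fun x hx => hf1.filter_mono (nhds_le_nhdsSet hx)⟩

/-- The divergence theorem on a closed hypersurface, for a field which is tangent to the level sets
of `ζ` in a neighbourhood of the hypersurface. -/
theorem integral_tangentDiv_eq_zero (hζ : ContDiff ℝ ∞ ζ) (hM : IsCompact (zeroSet ζ))
    (hG : ∀ x ∈ zeroSet ζ, 0 < gram ζ x)
    {X : EuclideanSpace ℝ (Fin d) → EuclideanSpace ℝ (Fin d)}
    (hX : ∀ x ∈ zeroSet ζ, ContDiffAt ℝ 1 X x)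
    (hXt : ∀ x, gram ζ x ≠ 0 → ⟪∇ ζ x, X x⟫ = 0) :
    ∫ x, tangentDiv ζ X x ∂surfaceMeasure ζ = 0 := by
  set O : Set (EuclideanSpace ℝ (Fin d)) :=
    interior {x | ContDiffAt ℝ 1 X x} ∩ {x | gram ζ x ≠ 0} with hO
  have hOo : IsOpen O := isOpen_interior.inter
    (isOpen_compl_singleton.preimage (contDiff_gram hζ).continuous)
  have hMO : zeroSet ζ ⊆ O := fun x hx =>
    ⟨mem_interior_iff_mem_nhds.2 ((hX x hx).eventually (by simp)), (hG x hx).ne'⟩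
  obtain ⟨χ, hχ, hχc, hχO, hχ1⟩ := exists_cutoff hM hOo hMO
  set W : EuclideanSpace ℝ (Fin d) → EuclideanSpace ℝ (Fin d) := fun y => χ y • X y with hWdef
  have hWχ : tsupport W ⊆ tsupport χ := closure_mono fun x hx h => hx (by simp [hWdef, h])
  have hW : ContDiff ℝ 1 W := contDiff_of_forall_mem_tsupport fun x hx =>
    (hχ.of_le (by simp)).contDiffAt.smul (interior_subset (hχO (hWχ hx)).1)
  have key := integral_tangentDiv_eq_zero_of_hasCompactSupport hζ hW
    (hχc.mono' ((subset_tsupport _).trans hWχ)) (fun x => ?_) (fun x hx h => ?_)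
  · rw [← key]
    refine setIntegral_congr_fun hM.measurableSet fun x hx => ?_
    refine Filter.EventuallyEq.tangentDiv_eq ?_
    filter_upwards [hχ1 x hx] with y hy
    simp [hWdef, hy]
  · rw [hWdef, inner_smul_right]
    by_cases hx : x ∈ tsupport χ
    · rw [hXt x (hχO hx).2, mul_zero]
    · rw [image_eq_zero_of_notMem_tsupport hx, zero_mul]
  · exact (hχO (hWχ hx)).2 (by simp [gram, h])

lemma isFiniteMeasure_surfaceMeasure (hζ : ContDiff ℝ ∞ ζ) (hM : IsCompact (zeroSet ζ))
    (hG : ∀ x ∈ zeroSet ζ, 0 < gram ζ x) : IsFiniteMeasure (surfaceMeasure ζ) := by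
  have := levelSet_measure_lt_top (hζ.of_le (by simp)) hM
    fun x hx h => (hG x hx).ne' (by simp [gram, h])
  rw [finrank_euclideanSpace_fin] at this
  exact ⟨by rwa [surfaceMeasure, Measure.restrict_apply_univ]⟩

lemma integrable_surfaceMeasure (hζ : ContDiff ℝ ∞ ζ) (hM : IsCompact (zeroSet ζ))
    (hG : ∀ x ∈ zeroSet ζ, 0 < gram ζ x) {F : EuclideanSpace ℝ (Fin d) → ℝ}
    (hF : ContinuousOn F (zeroSet ζ)) : Integrable F (surfaceMeasure ζ) := by
  have := isFiniteMeasure_surfaceMeasure hζ hM hG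
  obtain ⟨C, hC⟩ := hM.exists_bound_of_continuousOn hF
  refine Integrable.of_bound (hF.aestronglyMeasurable hM.measurableSet) C ?_
  exact ae_restrict_of_forall_mem hM.measurableSet hC

/-- Integration by parts on the hypersurface. Regularity is only required at its points, so that the
formula applies to fields involving negative powers of `gram ζ`. -/
theorem integralsAgree_surfaceMeasure (hζ : ContDiff ℝ ∞ ζ) (hM : IsCompact (zeroSet ζ))
    (hG : ∀ x ∈ zeroSet ζ, 0 < gram ζ x) {ψ : EuclideanSpace ℝ (Fin d) → ℝ}
    {H : EuclideanSpace ℝ (Fin d) → EuclideanSpace ℝ (Fin d)}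
    (hψ : ∀ x ∈ zeroSet ζ, ContDiffAt ℝ 1 ψ x) (hH : ∀ x ∈ zeroSet ζ, ContDiffAt ℝ 1 H x) :
    IntegralsAgree (surfaceMeasure ζ) (fun x => ⟪tangentGrad ζ ψ x, H x⟫)
      (fun x => -(ψ x * tangentDiv ζ (fun y => tangentProj ζ y (H y)) x)) := by
  set T : EuclideanSpace ℝ (Fin d) → EuclideanSpace ℝ (Fin d) := fun y => tangentProj ζ y (H y)
    with hTdef
  have hT : ∀ x ∈ zeroSet ζ, ContDiffAt ℝ 1 T x := fun x hx =>
    contDiffAt_tangentProj hζ (hG x hx).ne' (hH x hx)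
  have hI1 : Integrable (fun x => ⟪tangentGrad ζ ψ x, H x⟫) (surfaceMeasure ζ) := by
    refine integrable_surfaceMeasure hζ hM hG fun x hx => ContinuousAt.continuousWithinAt ?_
    have h1 : ContinuousAt (fderiv ℝ ψ) x :=
      ((hψ x hx).fderiv_right (m := 0) (by simp)).continuousAt
    have hg : ContinuousAt (∇ ζ) x := (contDiff_gradient hζ).continuous.continuousAt
    have hGr : ContinuousAt (gram ζ) x := (contDiff_gram hζ).continuous.continuousAt
    simp_rw [inner_tangentGrad]
    exact (h1.clm_apply (hH x hx).continuousAt).sub (((hGr.inv₀ (hG x hx).ne').mul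
      (hg.inner (hH x hx).continuousAt)).mul (h1.clm_apply hg))
  have hI2 : Integrable (fun x => ψ x * tangentDiv ζ T x) (surfaceMeasure ζ) :=
    integrable_surfaceMeasure hζ hM hG fun x hx => ((hψ x hx).continuousAt.mul
      (continuousAt_tangentDiv hζ (hG x hx).ne' (hT x hx))).continuousWithinAt
  refine ⟨hI1, hI2.neg, ?_⟩
  have key := integral_tangentDiv_eq_zero hζ hM hG (X := fun y => ψ y • T y)
    (fun x hx => (hψ x hx).smul (hT x hx)) fun x hx => by
      rw [inner_smul_right, inner_gradient_tangentProj hx, mul_zero]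
  have hcongr : ∫ x, tangentDiv ζ (fun y => ψ y • T y) x ∂surfaceMeasure ζ =
      ∫ x, (ψ x * tangentDiv ζ T x + ⟪tangentGrad ζ ψ x, H x⟫) ∂surfaceMeasure ζ := by
    refine setIntegral_congr_fun hM.measurableSet fun x hx => ?_
    rw [tangentDiv_smul ((hψ x hx).differentiableAt one_ne_zero)
      ((hT x hx).differentiableAt one_ne_zero), inner_tangentGrad_tangentProj (hG x hx).ne']
  rw [hcongr, integral_add hI2 hI1] at key
  rw [integral_neg]
  linarith

end Divergence

/-! ### The Gibbs measure -/

section Gibbs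

variable {d : ℕ} {ζ V : EuclideanSpace ℝ (Fin d) → ℝ} {σ : ℝ}

lemma gibbsDensity_nonneg (x : EuclideanSpace ℝ (Fin d)) : 0 ≤ gibbsDensity ζ V σ x :=
  mul_nonneg (inv_nonneg.2 (integral_nonneg fun _ => (Real.exp_pos _).le)) (Real.exp_pos _).le

lemma contDiff_gibbsDensity (hV : ContDiff ℝ ∞ V) : ContDiff ℝ ∞ (gibbsDensity ζ V σ) :=
  contDiff_const.mul (Real.contDiff_exp.comp (contDiff_const.mul hV))

lemma isProbabilityMeasure_gibbsMeasure (hζ : ContDiff ℝ ∞ ζ) (hM : IsCompact (zeroSet ζ))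
    (hG : ∀ x ∈ zeroSet ζ, 0 < gram ζ x) (hV : ContDiff ℝ ∞ V) (hne : (zeroSet ζ).Nonempty) :
    IsProbabilityMeasure (gibbsMeasure ζ V σ) := by
  obtain ⟨x₀, hx₀⟩ := hne
  have hpos : 0 < surfaceMeasure ζ (Function.support fun x => Real.exp (-(2 / σ ^ 2) * V x)) := by
    have h1 : (Function.support fun x => Real.exp (-(2 / σ ^ 2) * V x)) = univ :=
      eq_univ_of_forall fun x => (Real.exp_pos _).ne'
    have h2 := levelSet_measure_pos (hζ.of_le (by simp)) hx₀
      fun h => (hG x₀ hx₀).ne' (by simp [gram, h])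
    rw [finrank_euclideanSpace_fin] at h2
    rw [h1, surfaceMeasure, Measure.restrict_apply_univ]
    exact h2
  have hexp : Continuous fun x => Real.exp (-(2 / σ ^ 2) * V x) := by
    have := hV.continuous
    fun_prop
  have hI : Integrable (fun x => Real.exp (-(2 / σ ^ 2) * V x)) (surfaceMeasure ζ) :=
    integrable_surfaceMeasure hζ hM hG hexp.continuousOn
  have hZ : 0 < partitionFun ζ V σ :=
    (integral_pos_iff_support_of_nonneg (fun _ => (Real.exp_pos _).le) hI).2 hpos
  refine ⟨?_⟩
  rw [gibbsMeasure, withDensity_apply _ MeasurableSet.univ, Measure.restrict_univ,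
    ← ofReal_integral_eq_lintegral_ofReal
      (f := gibbsDensity ζ V σ) (hI.const_mul _) (.of_forall gibbsDensity_nonneg),
    ENNReal.ofReal_eq_one]
  simp only [gibbsDensity]
  rw [integral_const_mul]
  exact inv_mul_cancel₀ hZ.ne'

/-- The density of the Gibbs measure may be moved into the integrands. -/
lemma IntegralsAgree.gibbsMeasure {F K F' K' : EuclideanSpace ℝ (Fin d) → ℝ}
    (hM : IsCompact (zeroSet ζ)) (hV : ContDiff ℝ ∞ V)
    (h : IntegralsAgree (surfaceMeasure ζ) F' K')
    (hF : ∀ x ∈ zeroSet ζ, F' x = gibbsDensity ζ V σ x * F x)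
    (hK : ∀ x ∈ zeroSet ζ, K' x = gibbsDensity ζ V σ x * K x) :
    IntegralsAgree (gibbsMeasure ζ V σ) F K := by
  have hm : Measurable fun x => ENNReal.ofReal (gibbsDensity ζ V σ x) :=
    (contDiff_gibbsDensity hV).continuous.measurable.ennreal_ofReal
  have htop : ∀ᵐ x ∂surfaceMeasure ζ, ENNReal.ofReal (gibbsDensity ζ V σ x) < ⊤ :=
    .of_forall fun _ => ENNReal.ofReal_lt_top
  have htrans : ∀ {A A' : EuclideanSpace ℝ (Fin d) → ℝ},
      (∀ x ∈ zeroSet ζ, A' x = gibbsDensity ζ V σ x * A x) →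
      A' =ᵐ[surfaceMeasure ζ]
        fun x => (ENNReal.ofReal (gibbsDensity ζ V σ x)).toReal • A x := fun hA =>
    ae_restrict_of_forall_mem hM.measurableSet fun x hx => by
      simp only [hA x hx, ENNReal.toReal_ofReal (gibbsDensity_nonneg x), smul_eq_mul]
  obtain ⟨h1, h2, h3⟩ := h
  refine ⟨?_, ?_, ?_⟩
  · exact (integrable_withDensity_iff_integrable_smul' hm htop).2 (h1.congr (htrans hF))
  · exact (integrable_withDensity_iff_integrable_smul' hm htop).2 (h2.congr (htrans hK))
  · rw [ConstrainedLangevin.gibbsMeasure, integral_withDensity_eq_integral_toReal_smul hm htop,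
      integral_withDensity_eq_integral_toReal_smul hm htop, ← integral_congr_ae (htrans hF),
      ← integral_congr_ae (htrans hK), h3]

/-- The derivative of the weight `G ^ (-k) ρ_∞`. -/
lemma fderiv_weight_apply (hζ : ContDiff ℝ ∞ ζ) (hV : ContDiff ℝ ∞ V)
    {x : EuclideanSpace ℝ (Fin d)} (hG : 0 < gram ζ x) (k : ℝ) (v : EuclideanSpace ℝ (Fin d)) :
    fderiv ℝ (fun y => gram ζ y ^ (-k) * gibbsDensity ζ V σ y) x v =
      gibbsDensity ζ V σ x * (-(2 * k) * gram ζ x ^ (-(k + 1)) * ⟪∇ ζ x, fderiv ℝ (∇ ζ) x v⟫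
        - 2 / σ ^ 2 * gram ζ x ^ (-k) * ⟪∇ V x, v⟫) := by
  have hg := ((contDiff_gradient hζ).differentiable (by simp)).differentiableAt (x := x)
  have h1 : HasFDerivAt (gram ζ) (fderiv ℝ (gram ζ) x) x :=
    ((contDiff_gram hζ).differentiable (by simp) x).hasFDerivAt
  have h2 : fderiv ℝ (gram ζ) x v = 2 * ⟪∇ ζ x, fderiv ℝ (∇ ζ) x v⟫ := by
    have : gram ζ = fun y => ⟪∇ ζ y, ∇ ζ y⟫ := rfl
    rw [this, fderiv_inner_apply ℝ hg hg, real_inner_comm (∇ ζ x)]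
    ring
  have h3 := h1.rpow_const (p := -k) (Or.inl hG.ne')
  have h4 : HasFDerivAt V (fderiv ℝ V x) x := (hV.differentiable (by simp) x).hasFDerivAt
  have h5 : HasFDerivAt (gibbsDensity ζ V σ) _ x :=
    ((h4.const_mul (-(2 / σ ^ 2))).exp).const_mul (partitionFun ζ V σ)⁻¹
  have h6 : HasFDerivAt (fun y => gram ζ y ^ (-k) * gibbsDensity ζ V σ y) _ x := h3.mul h5
  rw [h6.fderiv]
  simp only [_root_.add_apply, _root_.smul_apply, smul_eq_mul, h2]
  rw [inner_gradient_left (f := V), gibbsDensity, show -k - 1 = -(k + 1) by ring]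
  ring

/-- Integration by parts for the field `G ^ (-k) ρ_∞ H`. The formula holds for every real `k`. -/
theorem integralsAgree_gibbsMeasure (hζ : ContDiff ℝ ∞ ζ) (hM : IsCompact (zeroSet ζ))
    (hG : ∀ x ∈ zeroSet ζ, 0 < gram ζ x) (hV : ContDiff ℝ ∞ V)
    {ψ : EuclideanSpace ℝ (Fin d) → ℝ} {H : EuclideanSpace ℝ (Fin d) → EuclideanSpace ℝ (Fin d)}
    (hψ : ContDiff ℝ ∞ ψ) (hH : ContDiff ℝ ∞ H) (k : ℝ) :
    IntegralsAgree (gibbsMeasure ζ V σ)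
      (fun x => gram ζ x ^ (-k) * fderiv ℝ ψ x (H x)
        - gram ζ x ^ (-(k + 1)) * ⟪∇ ζ x, H x⟫ * fderiv ℝ ψ x (∇ ζ x))
      (fun x => gram ζ x ^ (-(k + 1)) * ⟪∇ ζ x, fderiv ℝ H x (∇ ζ x)⟫ * ψ x
        - (2 * k + 1) * gram ζ x ^ (-(k + 2)) * ⟪∇ ζ x, fderiv ℝ (∇ ζ) x (∇ ζ x)⟫ *
            ⟪∇ ζ x, H x⟫ * ψ x
        - gram ζ x ^ (-k) * div H x * ψ x
        + 2 * k * gram ζ x ^ (-(k + 1)) * ⟪∇ ζ x, fderiv ℝ (∇ ζ) x (H x)⟫ * ψ x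
        + gram ζ x ^ (-(k + 1)) * div (∇ ζ) x * ⟪∇ ζ x, H x⟫ * ψ x
        + 2 / σ ^ 2 * gram ζ x ^ (-(k + 1)) * ⟪∇ ζ x, -∇ V x⟫ * ⟪∇ ζ x, H x⟫ * ψ x
        - 2 / σ ^ 2 * gram ζ x ^ (-k) * ⟪-∇ V x, H x⟫ * ψ x) := by
  set φ : EuclideanSpace ℝ (Fin d) → ℝ := fun y => gram ζ y ^ (-k) * gibbsDensity ζ V σ y with hφ
  have hφ1 : ∀ x ∈ zeroSet ζ, ContDiffAt ℝ 1 φ x := fun x hx =>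
    (((contDiff_gram hζ).of_le (by simp)).contDiffAt.rpow_const_of_ne (hG x hx).ne').mul
      ((contDiff_gibbsDensity hV).of_le (by simp)).contDiffAt
  have hH1 : ContDiff ℝ 1 H := hH.of_le (by simp)
  refine IntegralsAgree.gibbsMeasure hM hV (integralsAgree_surfaceMeasure hζ hM hG
    (ψ := ψ) (H := fun y => φ y • H y) (fun x _ => (hψ.of_le (by simp)).contDiffAt)
    (fun x hx => (hφ1 x hx).smul hH1.contDiffAt)) (fun x hx => ?_) (fun x hx => ?_)
  all_goals
    have hGx := hG x hx
    have hp1 : gram ζ x ^ (-(k + 1)) = gram ζ x ^ (-k) * (gram ζ x)⁻¹ := by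
      rw [neg_add, Real.rpow_add hGx, Real.rpow_neg_one]
  · rw [inner_smul_right, inner_tangentGrad, hp1]
    ring
  · have hp2 : gram ζ x ^ (-(k + 2)) = gram ζ x ^ (-k) * (gram ζ x)⁻¹ * (gram ζ x)⁻¹ := by
      rw [← hp1, ← Real.rpow_neg_one, ← Real.rpow_add hGx]
      congr 1
      ring
    have hφH : ContDiffAt ℝ 1 (fun y => φ y • H y) x := (hφ1 x hx).smul hH1.contDiffAt
    rw [tangentDiv_tangentProj hζ hGx.ne' hφH,
      tangentDiv_smul ((hφ1 x hx).differentiableAt one_ne_zero)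
        (hH1.differentiable one_ne_zero x), inner_tangentGrad, hφ,
      fderiv_weight_apply hζ hV hGx, fderiv_weight_apply hζ hV hGx, tangentDiv, tangentDiv,
      inner_smul_right, hp1, hp2, inner_neg_left, inner_neg_right, real_inner_comm (∇ ζ x) (∇ V x)]
    ring

end Gibbs

end ConstrainedLangevin

theorem mainTheorem6 (d : ℕ) (ζ : EuclideanSpace ℝ (Fin d) → ℝ) (hζ : ContDiff ℝ ∞ ζ)
    (hM : IsCompact (ConstrainedLangevin.zeroSet ζ))
    (hG : ∀ x ∈ ConstrainedLangevin.zeroSet ζ, 0 < ConstrainedLangevin.gram ζ x) :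
    (∀ (ψ : EuclideanSpace ℝ (Fin d) → ℝ)
        (H : EuclideanSpace ℝ (Fin d) → EuclideanSpace ℝ (Fin d)),
      ContDiff ℝ ∞ ψ → ContDiff ℝ ∞ H →
      ConstrainedLangevin.IntegralsAgree (ConstrainedLangevin.surfaceMeasure ζ)
        (fun x => ⟪ConstrainedLangevin.tangentGrad ζ ψ x, H x⟫)
        (fun x => -(ψ x *
          ConstrainedLangevin.tangentDiv ζ
            (fun y => ConstrainedLangevin.tangentProj ζ y (H y)) x))) ∧
    ∀ (V : EuclideanSpace ℝ (Fin d) → ℝ) (σ : ℝ), ContDiff ℝ ∞ V → 0 < σ →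
      ((ConstrainedLangevin.zeroSet ζ).Nonempty →
        IsProbabilityMeasure (ConstrainedLangevin.gibbsMeasure ζ V σ)) ∧
      ∀ (f g : EuclideanSpace ℝ (Fin d) → EuclideanSpace ℝ (Fin d))
        (G : EuclideanSpace ℝ (Fin d) → ℝ),
        (f = fun x => -∇ V x) → (g = fun x => ∇ ζ x) → G = ConstrainedLangevin.gram ζ →
      ∀ (ψ : EuclideanSpace ℝ (Fin d) → ℝ)
        (H : EuclideanSpace ℝ (Fin d) → EuclideanSpace ℝ (Fin d)) (k : ℝ),
        ContDiff ℝ ∞ ψ → ContDiff ℝ ∞ H → 0 ≤ k →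
        ConstrainedLangevin.IntegralsAgree (ConstrainedLangevin.gibbsMeasure ζ V σ)
          (fun x =>
            G x ^ (-k) * fderiv ℝ ψ x (H x)
              - G x ^ (-(k + 1)) * ⟪g x, H x⟫ * fderiv ℝ ψ x (g x))
          (fun x =>
            G x ^ (-(k + 1)) * ⟪g x, fderiv ℝ H x (g x)⟫ * ψ x
              - (2 * k + 1) * G x ^ (-(k + 2)) * ⟪g x, fderiv ℝ g x (g x)⟫ * ⟪g x, H x⟫ * ψ x
              - G x ^ (-k) * ConstrainedLangevin.div H x * ψ x
              + 2 * k * G x ^ (-(k + 1)) * ⟪g x, fderiv ℝ g x (H x)⟫ * ψ x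
              + G x ^ (-(k + 1)) * ConstrainedLangevin.div g x * ⟪g x, H x⟫ * ψ x
              + 2 / σ ^ 2 * G x ^ (-(k + 1)) * ⟪g x, f x⟫ * ⟪g x, H x⟫ * ψ x
              - 2 / σ ^ 2 * G x ^ (-k) * ⟪f x, H x⟫ * ψ x) := by
  refine ⟨fun ψ H hψ hH => ?_, fun V σ hV _ => ⟨fun hne => ?_, ?_⟩⟩
  · exact ConstrainedLangevin.integralsAgree_surfaceMeasure hζ hM hG
      (fun x _ => (hψ.of_le (by simp)).contDiffAt) (fun x _ => (hH.of_le (by simp)).contDiffAt)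
  · exact ConstrainedLangevin.isProbabilityMeasure_gibbsMeasure hζ hM hG hV hne
  · rintro f g G rfl rfl rfl ψ H k hψ hH -
    exact ConstrainedLangevin.integralsAgree_gibbsMeasure hζ hM hG hV hψ hH k
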